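/- Let a social system $x_{k+1}=Ax_k$ on finitely many states $\mathcal X$ have the zero/nonzero pattern of a digraph $\mathcal G=(\mathcal X,\mathcal E)$, where the link $x_i\leftarrow x_j$ is present iff the entry $a_{ij}$ is a free nonzero parameter. Finitely many agents $i=1,\dots,N$ take measurements $y^i=H_ix$, each individual measurement (row of $H_i$) being of a single state with a free nonzero coefficient. Agents share predictions over a directed network $\mathcal G_\beta$ and measurements over a directed network $\mathcal G_\alpha$; $\mathcal N_\beta(i)$ and $\mathcal N_\alpha(i)$ denote the sets consisting of agent $i$ and of the agents that send to $i$ over $\mathcal G_\beta$, respectively $\mathcal G_\alpha$. Let $W=(w_{ij})$ be a row-stochastic matrix with $w_{ij}\neq0$ iff $j\in\mathcal N_\beta(i)$, and let $D_H$ be the block-diagonal matrix with the blocks $\sum_{j\in\mathcal N_\alpha(i)}H_j^\top H_j$, $i=1,\dots,N$. A *parent SCC* is a strongly connected component of $\mathcal G$ without links to states outside of it. In the bipartite graph with the node sets $\mathcal V^+=\mathcal V^-=\mathcal X$ and an edge from $x_j\in\mathcal V^+$ to $x_i\in\mathcal V^-$ for every link $x_i\leftarrow x_j$, a *contraction* is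 a set consisting of all the nodes of $\mathcal V^+$ that can be reached from a node $v\in\mathcal V^+$ unmatched by a maximum matching $\mathcal M$ along $\mathcal M$-alternating paths ($v$ included), for any choice of $\mathcal M$ and $v$. An agent measuring a state in a contraction is called Type-$\alpha$, and one measuring a state in a parent SCC is called Type-$\beta$. Suppose that for every agent $i$: (i) for every contraction $\mathcal C$, some agent $j\in\mathcal N_\alpha(i)$ (that is, $i$ itself or an agent with a direct link to $i$) measures a state in $\mathcal C$; (ii) for every parent SCC $\mathcal S$, some agent $j$ that measures a state in $\mathcal S$ shares predictions with $i$ along directed paths of $\mathcal G_\beta$, from $j$ to $i$ and back from $i$ to $j$ (paths of length $0$ are allowed; if $\mathcal G_\beta$ is strongly connected, or if all of its links are bidirectional and there is a path from $j$ to $i$, such paths exist). Then the pair $(W\otimes A,D_H)$ is structurally observable: it is observable for some values of the nonzero parameters of $A$, $H_1,\dots,H_N$ and $W$ ($W$ stochastic), and in fact for Lebesgue-almost all values of the nonzero entries of $A$ and of $H_1,\dots,H_N$ and of the off-diagonal entries of $W$ on the links of $\mathcal G_\beta$ (the diagonal of $W$ being determined by the unit row sums). -/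

import Mathlib

open Matrix MeasureTheory
open scoped Kronecker

namespace CyberSocial

/-! ### Digraphs

A digraph on `V` is a relation `E : V → V → Prop`, where `E i j` means that there is a link `i ← j`
(for a system digraph: the entry `(i, j)` of the system matrix is a free nonzero parameter; for a
communication network: agent `j` sends information to agent `i`). -/

/-- There is a directed path (possibly of length zero) `x → ⋯ → y` along the links of `E`. -/
def HasPath {V : Type*} (E : V → V → Prop) (x y : V) : Prop :=
  Relation.ReflTransGen (fun a b => E b a) x y

/-- `S` is a strongly connected component of the digraph. -/
def IsSCC {V : Type*} (E : V → V → Prop) (S : Set V) : Prop :=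
  ∃ x, S = {y | HasPath E x y ∧ HasPath E y x}

/-- A parent SCC: a strongly connected component with no outgoing link to a node outside of it. -/
def IsParentSCC {V : Type*} (E : V → V → Prop) (S : Set V) : Prop :=
  IsSCC E S ∧ ∀ y ∈ S, ∀ x, E x y → x ∈ S

/-! ### Matchings and contractions

The bipartite representation has two copies of the node set: `Sum.inl j` stands for the node `j⁺`
and `Sum.inr i` for the node `i⁻`; a link `i ← j` gives the edge from `j⁺` to `i⁻`. An edge is
recorded as the pair `(i, j)`. -/

/-- A set of edges of the bipartite representation no two of which share an end node. -/
def IsMatching {V : Type*} (E : V → V → Prop) (M : Finset (V × V)) : Prop :=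
  (∀ e ∈ M, E e.1 e.2) ∧
    ∀ e ∈ M, ∀ f ∈ M, (e.1 = f.1 ∨ e.2 = f.2) → e = f

/-- A matching of maximum possible size. -/
def IsMaximumMatching {V : Type*} (E : V → V → Prop) (M : Finset (V × V)) : Prop :=
  IsMatching E M ∧ ∀ M', IsMatching E M' → M'.card ≤ M.card

/-- The node `j⁺` is not incident to any edge of `M`. -/
def IsUnmatched {V : Type*} (M : Finset (V × V)) (j : V) : Prop :=
  ∀ e ∈ M, e.2 ≠ j

/-- The directed edges of the auxiliary graph: edges outside `M` keep their direction (from `j⁺`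
to `i⁻`), edges in `M` are reversed (from `i⁻` to `j⁺`). Directed paths in it alternate. -/
inductive AuxEdge {V : Type*} (E : V → V → Prop) (M : Finset (V × V)) : V ⊕ V → V ⊕ V → Prop
  | keep {i j : V} (h : E i j) (hM : (i, j) ∉ M) : AuxEdge E M (Sum.inl j) (Sum.inr i)
  | reverse {i j : V} (hM : (i, j) ∈ M) : AuxEdge E M (Sum.inr i) (Sum.inl j)

/-- The nodes `x⁺` reachable from `v⁺` by `M`-alternating paths (including `v` itself). -/
def alternatingReach {V : Type*} (E : V → V → Prop) (M : Finset (V × V)) (v : V) : Set V :=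
  {x | Relation.ReflTransGen (AuxEdge E M) (Sum.inl v) (Sum.inl x)}

/-- A contraction of the digraph: for some maximum matching `M` and some unmatched node `v`, the
set of the nodes reachable from `v` by `M`-alternating paths. -/
def IsContraction {V : Type*} (E : V → V → Prop) (C : Set V) : Prop :=
  ∃ M, IsMaximumMatching E M ∧ ∃ v, IsUnmatched M v ∧ C = alternatingReach E M v

/-! ### Observability -/

/-- Observability of the pair `(F, G)`: the observability matrix with the blocks
`G, G F, …, G F ^ (card m - 1)` has trivial kernel, i.e. full column rank. -/
def IsObservable {m q : Type*} [Fintype m] [DecidableEq m] (F : Matrix m m ℝ) (G : Matrix q m ℝ) :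
    Prop :=
  ∀ v : m → ℝ, (∀ k < Fintype.card m, (G * F ^ k) *ᵥ v = 0) → v = 0

/-! ### Agents

`ι` is the set of agents. Agent `i` takes `p i` measurements, the `r`-th one of the state `s i r`;
`Gα i j` (`Gβ i j`) says that agent `j` sends its measurements (predictions) to agent `i`. -/

/-- Agent `j` measures a state in `S`. -/
def Measures {ι X : Type*} {p : ι → ℕ} (s : (i : ι) → Fin (p i) → X) (j : ι) (S : Set X) : Prop :=
  ∃ r, s j r ∈ S

/-- The neighborhood of agent `i` (which includes agent `i`). -/
def nbhd {ι : Type*} (G : ι → ι → Prop) (i : ι) : Set ι :=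
  {j | j = i ∨ G i j}

open Classical in
/-- The block diagonal matrix `D_H` whose `i`-th block is the sum of `H_jᵀ H_j` over the agents `j`
in the `Gα`-neighborhood of `i`. -/
noncomputable def DH {ι X : Type*} [Fintype ι] (Gα : ι → ι → Prop) {p : ι → ℕ}
    (H : (i : ι) → Matrix (Fin (p i)) X ℝ) : Matrix (ι × X) (ι × X) ℝ :=
  Matrix.of fun a b =>
    if a.1 = b.1 then
      (∑ j ∈ Finset.univ.filter (fun j => j ∈ nbhd Gα a.1), (H j)ᵀ * H j) a.2 b.2
    else 0

/-! ### Numerical values of the free parameters -/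

open Classical in
/-- The system matrix with the values `a` on the links of `E`, and zeros elsewhere. -/
noncomputable def systemMatrix {X : Type*} (E : X → X → Prop) (a : X → X → ℝ) : Matrix X X ℝ :=
  Matrix.of fun x y => if E x y then a x y else 0

open Classical in
/-- The weight matrix with unit row sums that has the values `w` on the links between different
agents; the weight that an agent gives to itself is determined by the row sum. -/
noncomputable def weightMatrix {ι : Type*} [Fintype ι] (Gβ : ι → ι → Prop) (w : ι → ι → ℝ) :
    Matrix ι ι ℝ :=
  Matrix.of fun i j =>
    if i = j then 1 - ∑ k ∈ Finset.univ.filter (fun k => k ≠ i ∧ Gβ i k), w i k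
    else if Gβ i j then w i j else 0

open Classical in
/-- The measurement matrices: row `r` of `H_i` has its only nonzero entry `h i r` at the state
`s i r`. -/
noncomputable def measurementMatrix {ι X : Type*} {p : ι → ℕ} (s : (i : ι) → Fin (p i) → X)
    (h : (i : ι) → Fin (p i) → ℝ) (i : ι) : Matrix (Fin (p i)) X ℝ :=
  Matrix.of fun r x => if x = s i r then h i r else 0

/-- Structural observability of the pair `(W ⊗ A, D_H)`, where `A` has the zero pattern of the
digraph `E`, `W` is stochastic with the pattern of `Gβ` (with a nonzero weight of each agent on
itself), and the measurement matrices have the pattern given by `s`: the pair is observable for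
some values of the nonzero parameters, and also for Lebesgue almost all of them. (The parameters
`a i j`, `w i j` that are not on a link do not occur in the matrices and do not affect what
"almost all" means.) -/
def IsStructurallyObservable {ι X : Type*} [Fintype ι] [DecidableEq ι] [Fintype X] [DecidableEq X]
    (E : X → X → Prop) (Gα Gβ : ι → ι → Prop) {p : ι → ℕ} (s : (i : ι) → Fin (p i) → X) : Prop :=
  (∃ (A : Matrix X X ℝ) (W : Matrix ι ι ℝ) (H : (i : ι) → Matrix (Fin (p i)) X ℝ),
      (∀ x y, A x y ≠ 0 ↔ E x y) ∧
      W ∈ rowStochastic ℝ ι ∧ (∀ i j, W i j ≠ 0 ↔ j ∈ nbhd Gβ i) ∧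
      (∀ i r x, H i r x ≠ 0 ↔ x = s i r) ∧
      IsObservable (W ⊗ₖ A) (DH Gα H)) ∧
  ∀ᵐ θ : (X → X → ℝ) × (ι → ι → ℝ) × ((i : ι) → Fin (p i) → ℝ) ∂volume,
    IsObservable (weightMatrix Gβ θ.2.1 ⊗ₖ systemMatrix E θ.1)
      (DH Gα (measurementMatrix s θ.2.2))

end CyberSocial

/-!
Observability means that the determinant of the Gramian is nonzero. This determinant is analytic
in the parameters, so that one good choice of parameters, even with zero or negative weights,
makes almost every choice good. By the Popov–Belevitch–Hautus test, a good choice is one for which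
no eigenvector of `W ⊗ A` vanishes on the measured coordinates.

By (i) and Hall's theorem, the states measured in the neighbourhood of an agent meet the
deficiency of the pattern of `A`: some permutation of the states follows a link from every state
that is not measured there. Hence generically no kernel vector of `A` vanishes on these states. By
(ii), in addition, the states measured by a strongly connected component of `𝒢_β` can be reached
from every state, and generically no eigenvector of `A` vanishes on all of them: to see this, add
the cycles of the permutation one by one with growing weights, each linked to the part already
treated.

It remains to choose `W`, block diagonal over the components of `𝒢_β`. On each component take it
diagonalizable, with distinct real eigenvalues and eigenvectors without zero entries, and replace
it by a generic affine combination `(1 - ε) I + ε W`, so that different eigenvalues of the weights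
never give the same product with nonzero eigenvalues of `A`. Then an eigenvector of `W ⊗ A` at a
nonzero eigenvalue is `q ⊗ z` with eigenvectors `q` and `z`, and since `q` has no zero entry, `z`
would vanish on all measurements of the component; at the eigenvalue zero each block is a kernel
vector of `A`.
-/

namespace CyberSocial

section Genericity

instance isAddHaarMeasure_volume_pi {κ : Type*} [Fintype κ] {V : κ → Type*}
    [∀ i, AddGroup (V i)] [∀ i, TopologicalSpace (V i)] [∀ i, MeasureSpace (V i)]
    [∀ i, SigmaFinite (volume : Measure (V i))]
    [∀ i, (volume : Measure (V i)).IsAddHaarMeasure] [∀ i, MeasurableAdd (V i)] :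
    (volume : Measure ((i : κ) → V i)).IsAddHaarMeasure :=
  inferInstanceAs (Measure.pi fun _ => volume).IsAddHaarMeasure

variable {V : Type*} [NormedAddCommGroup V] [NormedSpace ℝ V]

section NullZeroSet

variable [FiniteDimensional ℝ V] [MeasurableSpace V] [BorelSpace V]

lemma ae_ne_zero_of_analyticOnNhd {f : V → ℝ} (hf : AnalyticOnNhd ℝ f Set.univ) (θ₀ : V)
    (h₀ : f θ₀ ≠ 0) (μ : Measure V) [μ.IsAddHaarMeasure] : ∀ᵐ θ ∂μ, f θ ≠ 0 := by
  have hcont : Continuous f := continuousOn_univ.1 hf.continuousOn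
  have hline : ∀ y : V, ∀ᵐ t : ℝ, f (θ₀ + t • y) ≠ 0 := fun y => by
    have hg : AnalyticOnNhd ℝ (fun t : ℝ => f (θ₀ + t • y)) Set.univ := fun t _ =>
      AnalyticAt.fun_comp_of_eq (hf (θ₀ + t • y) trivial) (by fun_prop) rfl
    have hzeros := hg.preimage_zero_mem_codiscrete (x := 0) (by simpa using h₀)
    rw [← Measure.restrict_univ (μ := (volume : Measure ℝ))]
    exact ae_restrict_le_codiscreteWithin MeasurableSet.univ hzeros
  have hswap : ∀ᵐ t : ℝ, ∀ᵐ y ∂μ, f (θ₀ + t • y) ≠ 0 := by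
    rw [← Measure.ae_ae_comm (p := fun (y : V) (t : ℝ) => f (θ₀ + t • y) ≠ 0)]
    · exact .of_forall hline
    · exact (isOpen_ne_fun (by fun_prop) continuous_const).measurableSet
  obtain ⟨t, ht, ht0⟩ := (hswap.and (Measure.ae_ne volume 0)).exists
  have hsmul : μ ((fun x => t • x) ⁻¹' {x | ¬ f (θ₀ + x) ≠ 0}) = 0 := ht
  rw [Measure.addHaar_preimage_smul μ ht0, mul_eq_zero,
    or_iff_right (by simp [ht0])] at hsmul
  exact (measure_preimage_add μ θ₀ {x | ¬ f x ≠ 0}).symm.trans hsmul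

end NullZeroSet

/-- A matrix depending on parameters in such a way that every entry is real analytic. This is
stated entrywise, since matrices carry no canonical norm. -/
def HasAnalyticEntries {m n : Type*} (F : V → Matrix m n ℝ) : Prop :=
  ∀ i j, AnalyticOnNhd ℝ (fun θ => F θ i j) Set.univ

namespace HasAnalyticEntries

variable {l m n : Type*} {F : V → Matrix l m ℝ} {G : V → Matrix m n ℝ}

lemma const (M : Matrix m n ℝ) : HasAnalyticEntries fun _ : V => M :=
  fun _ _ => analyticOnNhd_const

lemma transpose (hG : HasAnalyticEntries G) : HasAnalyticEntries fun θ => (G θ)ᵀ :=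
  fun i j => hG j i

lemma mul [Fintype m] (hF : HasAnalyticEntries F) (hG : HasAnalyticEntries G) :
    HasAnalyticEntries fun θ => F θ * G θ := fun i j =>
  Finset.analyticOnNhd_fun_sum _ fun k _ => (hF i k).mul (hG k j)

lemma sum {κ : Type*} (s : Finset κ) {F : κ → V → Matrix l m ℝ}
    (hF : ∀ k ∈ s, HasAnalyticEntries (F k)) : HasAnalyticEntries fun θ => ∑ k ∈ s, F k θ :=
  fun i j => by
    simp only [Matrix.sum_apply]
    exact Finset.analyticOnNhd_fun_sum _ fun k hk => hF k hk i j

variable [Fintype m] [DecidableEq m] {F : V → Matrix m m ℝ}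

lemma pow (hF : HasAnalyticEntries F) : ∀ k : ℕ, HasAnalyticEntries fun θ => F θ ^ k
  | 0 => by simpa only [pow_zero] using const 1
  | k + 1 => by simpa only [pow_succ] using (pow hF k).mul hF

lemma det (hF : HasAnalyticEntries F) : AnalyticOnNhd ℝ (fun θ => (F θ).det) Set.univ := by
  simp only [Matrix.det_apply']
  exact Finset.analyticOnNhd_fun_sum _ fun σ _ =>
    analyticOnNhd_const.mul (Finset.analyticOnNhd_fun_prod _ fun i _ => hF (σ i) i)

end HasAnalyticEntries

lemma HasAnalyticEntries.systemMatrix {X : Type*} {a : V → X → X → ℝ}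
    (ha : ∀ x y, AnalyticOnNhd ℝ (fun θ => a θ x y) Set.univ) (E : X → X → Prop) :
    HasAnalyticEntries fun θ => systemMatrix E (a θ) := fun x y => by
  by_cases hxy : E x y
  · simpa only [CyberSocial.systemMatrix, Matrix.of_apply, if_pos hxy] using ha x y
  · simpa only [CyberSocial.systemMatrix, Matrix.of_apply, if_neg hxy] using analyticOnNhd_const

lemma analyticOnNhd_apply_apply {κ : Type*} [Fintype κ] {p : κ → Type*} [∀ i, Fintype (p i)]
    {g : V → (i : κ) → p i → ℝ} (hg : AnalyticOnNhd ℝ g Set.univ) (i : κ) (r : p i) :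
    AnalyticOnNhd ℝ (fun θ => g θ i r) Set.univ :=
  analyticOnNhd_pi_iff.1 (analyticOnNhd_pi_iff.1 hg i) r

end Genericity

section Gramian

lemma sum_transpose_mul_self_mulVec_eq_zero_iff {κ m : Type*} {q : κ → Type*}
    [∀ k, Fintype (q k)] [Fintype m] (s : Finset κ) (H : ∀ k, Matrix (q k) m ℝ) (v : m → ℝ) :
    (∑ k ∈ s, (H k)ᵀ * H k) *ᵥ v = 0 ↔ ∀ k ∈ s, H k *ᵥ v = 0 := by
  constructor
  · intro h
    have hsum : ∑ k ∈ s, (H k *ᵥ v) ⬝ᵥ (H k *ᵥ v) = v ⬝ᵥ ((∑ k ∈ s, (H k)ᵀ * H k) *ᵥ v) := by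
      rw [Matrix.sum_mulVec, dotProduct_sum]
      refine Finset.sum_congr rfl fun k _ => ?_
      rw [← Matrix.mulVec_mulVec, Matrix.dotProduct_mulVec v, Matrix.vecMul_transpose]
    rw [h, dotProduct_zero] at hsum
    have hterm := (Finset.sum_eq_zero_iff_of_nonneg fun k _ =>
      Finset.sum_nonneg fun i _ => mul_self_nonneg _).1 hsum
    exact fun k hk => dotProduct_self_eq_zero.1 (hterm k hk)
  · intro h
    rw [Matrix.sum_mulVec]
    refine Finset.sum_eq_zero fun k hk => ?_
    rw [← Matrix.mulVec_mulVec, h k hk, Matrix.mulVec_zero]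

variable {m q : Type*} [Fintype m] [DecidableEq m]

/-- The observability Gramian of the pair `(F, G)`, a square matrix whose determinant decides
observability. -/
def gramian [Fintype q] (F : Matrix m m ℝ) (G : Matrix q m ℝ) : Matrix m m ℝ :=
  ∑ k ∈ Finset.range (Fintype.card m), (G * F ^ k)ᵀ * (G * F ^ k)

lemma isObservable_iff_det_gramian_ne_zero [Fintype q] (F : Matrix m m ℝ)
    (G : Matrix q m ℝ) : IsObservable F G ↔ (gramian F G).det ≠ 0 := by
  rw [Ne, ← Matrix.exists_mulVec_eq_zero_iff, gramian]
  simp only [sum_transpose_mul_self_mulVec_eq_zero_iff, Finset.mem_range, not_exists, not_and']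
  exact forall_congr' fun v => imp_congr_right fun _ => not_not.symm

lemma ae_isObservable [Finite q] {V : Type*} [NormedAddCommGroup V] [NormedSpace ℝ V]
    [FiniteDimensional ℝ V] [MeasurableSpace V] [BorelSpace V] {F : V → Matrix m m ℝ}
    {G : V → Matrix q m ℝ} (hF : HasAnalyticEntries F) (hG : HasAnalyticEntries G) (θ₀ : V)
    (h₀ : IsObservable (F θ₀) (G θ₀)) (μ : Measure V) [μ.IsAddHaarMeasure] :
    ∀ᵐ θ ∂μ, IsObservable (F θ) (G θ) := by
  have := Fintype.ofFinite q
  simp only [isObservable_iff_det_gramian_ne_zero] at h₀ ⊢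
  refine ae_ne_zero_of_analyticOnNhd ?_ θ₀ h₀ μ
  have hGF : ∀ k, HasAnalyticEntries fun θ => G θ * F θ ^ k := fun k => hG.mul (hF.pow k)
  exact (HasAnalyticEntries.sum _ fun k _ => (hGF k).transpose.mul (hGF k)).det

end Gramian

section EigenvectorTest

lemma eq_zero_of_forall_pow_mem {K V : Type*} [Field K] [IsAlgClosed K] [AddCommGroup V]
    [Module K V] [FiniteDimensional K V] (f : Module.End K V) (S : Submodule K V)
    (hS : ∀ (c : K) (v : V), f v = c • v → v ∈ S → v = 0) (v : V)
    (hv : ∀ k : ℕ, (f ^ k) v ∈ S) : v = 0 := by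
  set U : Submodule K V := ⨅ k : ℕ, S.comap (f ^ k)
  have mem_U : ∀ x, x ∈ U ↔ ∀ k : ℕ, (f ^ k) x ∈ S := fun x => by simp [U, Submodule.mem_iInf]
  have hinv : ∀ x ∈ U, f x ∈ U := fun x hx => (mem_U _).2 fun k => by
    simpa only [pow_succ, Module.End.mul_apply] using (mem_U x).1 hx (k + 1)
  by_contra hne
  have : Nontrivial U := ⟨⟨⟨v, (mem_U v).2 hv⟩, 0, fun h => hne (congrArg Subtype.val h)⟩⟩
  obtain ⟨c, hc⟩ := Module.End.exists_eigenvalue (f.restrict hinv)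
  obtain ⟨x, hx⟩ := hc.exists_hasEigenvector
  exact hx.2 (Subtype.ext (hS c x.1 (congrArg Subtype.val hx.apply_eq_smul)
    (by simpa using (mem_U x.1).1 x.2 0)))

/-- The complexification of a real matrix. -/
noncomputable abbrev complexify {m n : Type*} (A : Matrix m n ℝ) : Matrix m n ℂ :=
  A.map Complex.ofRealHom

/-- No complex eigenvector of `F` vanishes on the set `Y` of measured coordinates. By the
Popov–Belevitch–Hautus test, this is observability of `F` from the coordinates in `Y`. -/
def NoHiddenMode {m : Type*} [Fintype m] (F : Matrix m m ℝ) (Y : Set m) : Prop :=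
  ∀ (c : ℂ) (z : m → ℂ), complexify F *ᵥ z = c • z → (∀ y ∈ Y, z y = 0) → z = 0

lemma complexify_pow {m : Type*} [Fintype m] [DecidableEq m] (F : Matrix m m ℝ) (k : ℕ) :
    complexify (F ^ k) = complexify F ^ k :=
  map_pow Complex.ofRealHom.mapMatrix F k

section PowerCriterion

variable {m q : Type*} [Fintype m]

lemma complexify_mulVec_ofReal (F : Matrix q m ℝ) (v : m → ℝ) (x : q) :
    (complexify F *ᵥ fun y => (v y : ℂ)) x = ((F *ᵥ v) x : ℂ) := by
  simp [Matrix.mulVec, dotProduct]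

lemma mulVec_re (F : Matrix q m ℝ) (z : m → ℂ) (x : q) :
    (F *ᵥ fun y => (z y).re) x = ((complexify F *ᵥ z) x).re := by
  simp [Matrix.mulVec, dotProduct]

lemma mulVec_im (F : Matrix q m ℝ) (z : m → ℂ) (x : q) :
    (F *ᵥ fun y => (z y).im) x = ((complexify F *ᵥ z) x).im := by
  simp [Matrix.mulVec, dotProduct]

lemma NoHiddenMode.mono {F : Matrix m m ℝ} {Y Y' : Set m} (h : NoHiddenMode F Y) (hY : Y ⊆ Y') :
    NoHiddenMode F Y' := fun c z hz hY' => h c z hz fun y hy => hY' y (hY hy)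

variable [DecidableEq m]

lemma pow_mulVec_eq_smul {R : Type*} [CommRing R] {F : Matrix m m R} {c : R} {z : m → R}
    (h : F *ᵥ z = c • z) (k : ℕ) : (F ^ k) *ᵥ z = c ^ k • z := by
  induction k with
  | zero => simp
  | succ k ih =>
    rw [pow_succ, ← Matrix.mulVec_mulVec, h, Matrix.mulVec_smul, ih, smul_smul, pow_succ']

lemma pow_mulVec_apply_eq_zero {R : Type*} [CommRing R] [Nontrivial R] {F : Matrix m m R}
    {v : m → R} {y : m} (h : ∀ k < Fintype.card m, ((F ^ k) *ᵥ v) y = 0) (k : ℕ) :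
    ((F ^ k) *ᵥ v) y = 0 := by
  have : Nonempty m := ⟨y⟩
  have hcharpoly : F.charpoly ≠ 1 := fun h1 => Fintype.card_ne_zero (α := m) <| by
    rw [← F.charpoly_natDegree_eq_dim, h1, Polynomial.natDegree_one]
  have hdeg : (Polynomial.X ^ k %ₘ F.charpoly).natDegree < Fintype.card m :=
    (Polynomial.natDegree_modByMonic_lt _ F.charpoly_monic hcharpoly).trans_eq
      F.charpoly_natDegree_eq_dim
  rw [Matrix.pow_eq_aeval_mod_charpoly, Polynomial.aeval_eq_sum_range' hdeg, Matrix.sum_mulVec,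
    Finset.sum_apply]
  refine Finset.sum_eq_zero fun j hj => ?_
  rw [Matrix.smul_mulVec, Pi.smul_apply, h j (Finset.mem_range.1 hj), smul_zero]

lemma isObservable_iff_forall_pow_mulVec {F : Matrix m m ℝ} {G : Matrix q m ℝ} {Y : Set m}
    (hG : ∀ v, G *ᵥ v = 0 ↔ ∀ y ∈ Y, v y = 0) :
    IsObservable F G ↔ ∀ v : m → ℝ, (∀ k : ℕ, ∀ y ∈ Y, ((F ^ k) *ᵥ v) y = 0) → v = 0 := by
  simp only [IsObservable, ← Matrix.mulVec_mulVec, hG]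
  exact ⟨fun h v hv => h v fun k _ => hv k,
    fun h v hv => h v fun k y hy => pow_mulVec_apply_eq_zero (fun k hk => hv k hk y hy) k⟩

lemma noHiddenMode_iff_forall_pow_mulVec {F : Matrix m m ℝ} {Y : Set m} :
    NoHiddenMode F Y ↔ ∀ v : m → ℝ, (∀ k : ℕ, ∀ y ∈ Y, ((F ^ k) *ᵥ v) y = 0) → v = 0 := by
  constructor
  · intro h v hv
    let S : Submodule ℂ (m → ℂ) := Submodule.pi Y fun _ => ⊥
    have hz := eq_zero_of_forall_pow_mem (Matrix.toLinAlgEquiv' (complexify F)) S h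
      (fun x => (v x : ℂ)) fun k y hy => by
        rw [← map_pow, ← complexify_pow]
        exact (complexify_mulVec_ofReal _ _ _).trans (by rw [hv k y hy, Complex.ofReal_zero])
    exact funext fun x => Complex.ofReal_eq_zero.1 (congrFun hz x)
  · intro h c z hz hzY
    have hpow : ∀ k, ∀ y ∈ Y, (complexify (F ^ k) *ᵥ z) y = 0 := fun k y hy => by
      rw [complexify_pow, pow_mulVec_eq_smul hz, Pi.smul_apply, hzY y hy, smul_zero]
    have hre := h (fun x => (z x).re) fun k y hy => by
      rw [mulVec_re, hpow k y hy, Complex.zero_re]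
    have him := h (fun x => (z x).im) fun k y hy => by
      rw [mulVec_im, hpow k y hy, Complex.zero_im]
    exact funext fun x => Complex.ext (congrFun hre x) (congrFun him x)

lemma isObservable_iff_noHiddenMode {F : Matrix m m ℝ} {G : Matrix q m ℝ} {Y : Set m}
    (hG : ∀ v, G *ᵥ v = 0 ↔ ∀ y ∈ Y, v y = 0) : IsObservable F G ↔ NoHiddenMode F Y :=
  (isObservable_iff_forall_pow_mulVec hG).trans noHiddenMode_iff_forall_pow_mulVec.symm

lemma diagonal_indicator_mulVec_eq_zero_iff {R : Type*} [NonAssocSemiring R] (Y : Set m)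
    (v : m → R) : Matrix.diagonal (Y.indicator 1) *ᵥ v = 0 ↔ ∀ y ∈ Y, v y = 0 := by
  classical
  simp [funext_iff, Matrix.mulVec_diagonal, Set.indicator_apply]

end PowerCriterion

lemma ae_noHiddenMode {m V : Type*} [Fintype m] [NormedAddCommGroup V] [NormedSpace ℝ V]
    [FiniteDimensional ℝ V] [MeasurableSpace V] [BorelSpace V] {F : V → Matrix m m ℝ}
    (hF : HasAnalyticEntries F) {Y : Set m} (θ₀ : V) (h₀ : NoHiddenMode (F θ₀) Y)
    (μ : Measure V) [μ.IsAddHaarMeasure] : ∀ᵐ θ ∂μ, NoHiddenMode (F θ) Y := by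
  classical
  have hiff : ∀ θ, IsObservable (F θ) (Matrix.diagonal (Y.indicator 1)) ↔ NoHiddenMode (F θ) Y :=
    fun θ => isObservable_iff_noHiddenMode (diagonal_indicator_mulVec_eq_zero_iff Y)
  simp only [← hiff] at h₀ ⊢
  exact ae_isObservable hF (.const _) θ₀ h₀ μ

end EigenvectorTest

section Contractions

lemma exists_hasPath_of_forall_isParentSCC {V : Type*} [Finite V] {E : V → V → Prop} {Y : Set V}
    (hY : ∀ S, IsParentSCC E S → ∃ y ∈ Y, y ∈ S) (x : V) : ∃ y ∈ Y, HasPath E x y := by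
  -- a node reachable from `x` that reaches as few nodes as possible lies in a parent component
  obtain ⟨z, hxz, hmin⟩ := Set.exists_min_image {z | HasPath E x z}
    (fun z => Set.ncard {w | HasPath E z w}) (Set.toFinite _) ⟨x, Relation.ReflTransGen.refl⟩
  have hreturn : ∀ u, HasPath E z u → HasPath E u z := fun u hzu => by
    have hsub : {w | HasPath E u w} ⊆ {w | HasPath E z w} := fun w hw => hzu.trans hw
    have heq := Set.eq_of_subset_of_ncard_le hsub (hmin u (hxz.trans hzu)) (Set.toFinite _)
    exact heq.ge (Relation.ReflTransGen.refl : HasPath E z z)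
  obtain ⟨y, hyY, hzy, -⟩ := hY {w | HasPath E z w ∧ HasPath E w z}
    ⟨⟨z, rfl⟩, fun y hy u huy => ⟨hy.1.tail huy, hreturn u (hy.1.tail huy)⟩⟩
  exact ⟨y, hyY, hxz.trans hzy⟩

lemma exists_isMaximumMatching {V : Type*} [Finite V] (E : V → V → Prop) :
    ∃ M, IsMaximumMatching E M := by
  obtain ⟨M, hM, hmax⟩ := Set.exists_max_image {M | IsMatching E M} Finset.card
    (Set.toFinite _) ⟨∅, by simp [IsMatching]⟩
  exact ⟨M, hM, hmax⟩

lemma IsMatching.union {V : Type*} [DecidableEq V] {E : V → V → Prop} {M P : Finset (V × V)}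
    (hM : IsMatching E M) (hP : IsMatching E P)
    (hMP : ∀ e ∈ M, ∀ f ∈ P, e.1 ≠ f.1 ∧ e.2 ≠ f.2) : IsMatching E (M ∪ P) := by
  simp only [IsMatching, Finset.mem_union] at *
  refine ⟨fun e he => he.elim (hM.1 e) (hP.1 e), ?_⟩
  rintro e (he | he) f (hf | hf) h
  · exact hM.2 e he f hf h
  · exact absurd h (not_or.2 (hMP e he f hf))
  · exact absurd (h.imp Eq.symm Eq.symm) (not_or.2 (hMP f hf e he))
  · exact hP.2 e he f hf h

lemma IsMaximumMatching.exchange {V : Type*} [DecidableEq V] {E : V → V → Prop}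
    {M P : Finset (V × V)} {N : Finset V} (hM : IsMaximumMatching E M) (hP : IsMatching E P)
    (hPN : ∀ e ∈ P, ∀ i, E i e.2 → i ∈ N) (hcard : N.card ≤ P.card) :
    IsMaximumMatching E (M.filter (fun e => e.1 ∉ N) ∪ P) := by
  have hfilter : IsMatching E (M.filter fun e => e.1 ∉ N) :=
    ⟨fun e he => hM.1.1 e (Finset.mem_filter.1 he).1,
      fun e he f hf => hM.1.2 e (Finset.mem_filter.1 he).1 f (Finset.mem_filter.1 hf).1⟩
  have hdisj : ∀ e ∈ M.filter (fun e => e.1 ∉ N), ∀ f ∈ P, e.1 ≠ f.1 ∧ e.2 ≠ f.2 := by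
    intro e he f hf
    obtain ⟨heM, heN⟩ := Finset.mem_filter.1 he
    exact ⟨fun h => heN (h ▸ hPN f hf f.1 (hP.1 f hf)),
      fun h => heN (hPN f hf e.1 (h ▸ hM.1.1 e heM))⟩
  refine ⟨hfilter.union hP hdisj, fun M' hM' => (hM.2 M' hM').trans ?_⟩
  have hremoved : (M.filter fun e => e.1 ∈ N).card ≤ N.card :=
    Finset.card_le_card_of_injOn Prod.fst (fun e he => (Finset.mem_filter.1 he).2)
      fun e he f hf h => hM.1.2 e (Finset.mem_filter.1 he).1 f (Finset.mem_filter.1 hf).1 (.inl h)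
  rw [Finset.card_union_of_disjoint
    (Finset.disjoint_left.2 fun e he hf => (hdisj e he e hf).1 rfl)]
  have hsplit := Finset.card_filter_add_card_filter_not (s := M) (fun e => e.1 ∈ N)
  omega

lemma alternatingReach_subset {V : Type*} {E : V → V → Prop} {M : Finset (V × V)} {J N : Set V}
    {v : V} (hv : v ∈ J) (hN : ∀ j ∈ J, ∀ i, E i j → i ∈ N)
    (hM : ∀ e ∈ M, e.1 ∈ N → e.2 ∈ J) : alternatingReach E M v ⊆ J := by
  have hreach : ∀ u, Relation.ReflTransGen (AuxEdge E M) (Sum.inl v) u →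
      Sum.elim (· ∈ J) (· ∈ N) u := fun u hu => by
    induction hu with
    | refl => exact hv
    | tail _ hstep ih =>
      cases hstep with
      | keep h _ => exact hN _ ih _ h
      | reverse h => exact hM _ h ih
  exact fun x hx => hreach _ hx

lemma exists_minimal_hall_violator {α β : Type*} [Finite α] [Fintype β] [DecidableEq α]
    {r : α → β → Prop} [∀ a, DecidablePred (r a)]
    (h : ¬ ∃ f : α → β, Function.Injective f ∧ ∀ a, r a (f a)) :
    ∃ J : Finset α, (Finset.univ.filter fun b => ∃ a ∈ J, r a b).card < J.card ∧
      ∀ v ∈ J, ∃ g : J.erase v → β, Function.Injective g ∧ ∀ a : J.erase v, r a (g a) := by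
  have := Fintype.ofFinite α
  rw [← Fintype.all_card_le_filter_rel_iff_exists_injective] at h
  push Not at h
  obtain ⟨J, hJ, hmin⟩ := Set.exists_min_image
    {J : Finset α | (Finset.univ.filter fun b => ∃ a ∈ J, r a b).card < J.card} Finset.card
    (Set.toFinite _) h
  refine ⟨J, hJ, fun v hv => (Fintype.all_card_le_filter_rel_iff_exists_injective
    fun (a : J.erase v) => r a).1 fun A => ?_⟩
  by_contra! hA
  have hsub : A.map (Function.Embedding.subtype _) ⊆ J.erase v := fun x hx => by
    obtain ⟨a, -, rfl⟩ := Finset.mem_map.1 hx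
    exact a.2
  have hlt := (Finset.card_le_card hsub).trans_lt (Finset.card_erase_lt_of_mem hv)
  refine (hmin (A.map (Function.Embedding.subtype _)) ?_).not_gt hlt
  simpa using hA

lemma exists_isContraction_subset {V : Type*} [Finite V] [DecidableEq V] {E : V → V → Prop}
    {J N : Finset V} (hN : ∀ j ∈ J, ∀ i, E i j → i ∈ N) (hcard : N.card < J.card) {v : V}
    (hv : v ∈ J) {g : J.erase v → V} (hg : Function.Injective g)
    (hgE : ∀ j : J.erase v, E (g j) j) : ∃ C, IsContraction E C ∧ C ⊆ J := by
  have := Fintype.ofFinite V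
  have hJv : ∀ j : J.erase v, j.1 ∈ J := fun j => Finset.mem_of_mem_erase j.2
  set P : Finset (V × V) := Finset.univ.image fun j => (g j, j.1)
  have hP : IsMatching E P := by
    simp only [P, IsMatching, Finset.forall_mem_image]
    exact ⟨fun j _ => hgE j, fun j _ k _ h => by rw [h.elim (fun h => hg h) Subtype.ext]⟩
  have hPcard : N.card ≤ P.card := by
    rw [Finset.card_image_of_injective _ fun j k h => hg (Prod.ext_iff.1 h).1, Finset.card_univ,
      Fintype.card_coe, Finset.card_erase_of_mem hv]
    omega
  obtain ⟨M, hM⟩ := exists_isMaximumMatching E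
  have hMP := hM.exchange hP (Finset.forall_mem_image.2 fun j _ => hN j (hJv j)) hPcard
  have hends : ∀ e ∈ M.filter (fun e => e.1 ∉ N) ∪ P, e.1 ∉ N ∨ e.2 ∈ J.erase v := fun e he => by
    simp only [P, Finset.mem_union, Finset.mem_filter, Finset.mem_image] at he
    exact he.imp And.right fun ⟨j, _, hj⟩ => hj ▸ j.2
  have hunmatched : IsUnmatched (M.filter (fun e => e.1 ∉ N) ∪ P) v := by
    rintro e he rfl
    exact (hends e he).elim (fun h => h (hN _ hv _ (hMP.1.1 e he))) (Finset.notMem_erase _ _)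
  exact ⟨_, ⟨_, hMP, v, hunmatched, rfl⟩, alternatingReach_subset (N := N) hv hN fun e he h =>
    Finset.mem_of_mem_erase ((hends e he).resolve_left (not_not.2 h))⟩

lemma exists_perm_of_forall_isContraction {V : Type*} [Finite V] {E : V → V → Prop} {Y : Set V}
    (hY : ∀ C, IsContraction E C → ∃ y ∈ Y, y ∈ C) :
    ∃ π : Equiv.Perm V, ∀ j, j ∈ Y ∨ E (π j) j := by
  classical
  have := Fintype.ofFinite V
  suffices h : ∃ f : V → V, Function.Injective f ∧ ∀ j, j ∈ Y ∨ E (f j) j by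
    obtain ⟨f, hf, h⟩ := h
    exact ⟨Equiv.ofBijective f (Finite.injective_iff_bijective.1 hf), h⟩
  by_contra hno
  obtain ⟨J, hJ, hmin⟩ := exists_minimal_hall_violator (r := fun j i => j ∈ Y ∨ E i j) hno
  have hJY : ∀ j ∈ J, j ∉ Y := fun j hj hjY => by
    rw [Finset.filter_true_of_mem fun i _ => ⟨j, hj, Or.inl hjY⟩] at hJ
    exact hJ.not_ge (Finset.card_le_univ J)
  obtain ⟨v, hv⟩ : J.Nonempty := Finset.card_pos.1 (Nat.zero_lt_of_lt hJ)
  obtain ⟨g, hg, hgE⟩ := hmin v hv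
  obtain ⟨C, hC, hCJ⟩ := exists_isContraction_subset
    (fun j hj i h => Finset.mem_filter.2 ⟨Finset.mem_univ i, j, hj, .inr h⟩) hJ hv hg
    fun j => (hgE j).resolve_left (hJY j (Finset.mem_of_mem_erase j.2))
  obtain ⟨y, hyY, hyC⟩ := hY C hC
  exact hJY y (hCJ hyC) hyY

end Contractions

section SpanningCycles

lemma of_sameCycle {X : Type*} [Finite X] {σ : Equiv.Perm X} {p : X → Prop} {j i : X}
    (hji : σ.SameCycle j i) (hj : p j)
    (hstep : ∀ b, σ.SameCycle j b → p b → b ≠ i → p (σ b)) : p i := by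
  have := Fintype.ofFinite X
  by_contra hi
  have hpow : ∀ n : ℕ, p ((σ ^ n) j) := fun n => by
    induction n with
    | zero => exact hj
    | succ n ih =>
      rw [pow_succ', Equiv.Perm.mul_apply]
      exact hstep _ (Equiv.Perm.sameCycle_pow_right.2 (.refl σ j)) ih fun h => hi (h ▸ ih)
  obtain ⟨n, -, hn⟩ := hji.exists_pow_eq'
  exact hi (hn ▸ hpow n)

section CycleEquations

variable {X : Type*} [Finite X] {π : Equiv.Perm X} {j : X} {c w : ℂ} {z : X → ℂ}

lemma norm_eq_of_cycle (hcyc : ∀ a, π.SameCycle j a → c * z a = w * z (π.symm a))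
    (hz : z j ≠ 0) : ‖c‖ = ‖w‖ := by
  have hpow : ∀ n : ℕ, c ^ n * z ((π ^ n) j) = w ^ n * z j := fun n => by
    induction n with
    | zero => simp
    | succ n ih =>
      rw [pow_succ c, mul_assoc, hcyc _ (Equiv.Perm.sameCycle_pow_right.2 (.refl π j)), pow_succ' π,
        Equiv.Perm.mul_apply, Equiv.symm_apply_apply, mul_left_comm, ih, pow_succ' w, mul_assoc]
  have hround := hpow (orderOf π)
  rw [pow_orderOf_eq_one, Equiv.Perm.one_apply] at hround
  have hnorm := congrArg norm (mul_right_cancel₀ hz hround)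
  rw [norm_pow, norm_pow] at hnorm
  exact (pow_left_inj₀ (norm_nonneg _) (norm_nonneg _) (orderOf_pos π).ne').1 hnorm

lemma eq_zero_of_cycle (hcyc : ∀ a, π.SameCycle j a → c * z a = w * z (π.symm a)) (hw : w ≠ 0)
    (hz : z j = 0) {k : X} (hk : π.SameCycle j k) : z k = 0 := by
  refine of_sameCycle (p := fun k => z k = 0) hk.inv hz fun b hb hzb _ => ?_
  have h := hcyc b hb.of_inv
  rw [hzb, mul_zero, eq_comm] at h
  exact (mul_eq_zero.1 h).resolve_left hw

lemma input_eq_zero_of_cycle [DecidableEq X] {i : X} {s : ℂ}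
    (hcyc : ∀ a, π.SameCycle j a →
      c * z a = w * z (π.symm a) + (Pi.single i s : X → ℂ) a)
    (hw : w ≠ 0) (hc : c ≠ 0) (hz : z j = 0) (hi : π.SameCycle j i) : s = 0 := by
  have hforward : z (π.symm i) = 0 := by
    refine of_sameCycle (p := fun k => z k = 0) (Equiv.Perm.sameCycle_symm_apply_right.2 hi) hz
      fun b hb hzb hbi => ?_
    have h := hcyc (π b) hb.apply_right
    rw [π.symm_apply_apply, hzb, Pi.single_eq_of_ne fun h => hbi (π.eq_symm_apply.2 h), mul_zero,
      add_zero] at h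
    exact (mul_eq_zero.1 h).resolve_left hc
  have hbackward : z i = 0 := by
    refine of_sameCycle (p := fun k => z k = 0) hi.inv hz fun b hb hzb hbi => ?_
    have h := hcyc b hb.of_inv
    rw [hzb, Pi.single_eq_of_ne hbi, mul_zero, add_zero, eq_comm] at h
    exact (mul_eq_zero.1 h).resolve_left hw
  have h := hcyc i hi
  rw [hforward, hbackward, Pi.single_eq_same, mul_zero, mul_zero, zero_add] at h
  exact h.symm

end CycleEquations

/-- The matrix `A` lives on the states of `Z` and has the pattern `R` there, except that the
columns in `Y` are free. -/
def IsSupportedBlock {X : Type*} (R : X → X → Prop) (A : Matrix X X ℝ) (Y Z : Set X) : Prop :=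
  ∀ a b, A a b ≠ 0 → a ∈ Z ∧ b ∈ Z ∧ (b ∈ Y ∨ R a b)

section Support

variable {X : Type*} [Fintype X] {A : Matrix X X ℝ} {R : X → X → Prop} {Y Z : Set X}

lemma IsSupportedBlock.mulVec_indicator (hA : IsSupportedBlock R A Y Z) (z : X → ℂ) :
    complexify A *ᵥ Z.indicator z = complexify A *ᵥ z := by
  ext a
  refine Finset.sum_congr rfl fun b _ => ?_
  by_cases hb : b ∈ Z
  · rw [Set.indicator_of_mem hb]
  · simp [by_contra fun h : A a b ≠ 0 => hb (hA a b h).2.1]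

lemma IsSupportedBlock.mulVec_eq_zero_of_notMem (hA : IsSupportedBlock R A Y Z) (z : X → ℂ)
    {a : X} (ha : a ∉ Z) : (complexify A *ᵥ z) a = 0 :=
  Finset.sum_eq_zero fun b _ => by
    simp [by_contra fun h : A a b ≠ 0 => ha (hA a b h).1]

end Support

section ObservableBlock

variable {X : Type*} [Fintype X] [DecidableEq X]

/-- In the frequency domain, a state vector of the system `A` supported in `Z` and driven by an
input at a single state of `Z` is zero as soon as it vanishes on `Y`, provided that the input is
zero or the frequency `c` exceeds `r` in modulus. Without input this is `NoHiddenMode` for the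
block on `Z`; the inputs make the notion stable under adding a cycle that drives the block. -/
def IsObservableBlock (A : Matrix X X ℝ) (Y Z : Set X) (r : ℝ) : Prop :=
  ∀ (c : ℂ) (z : X → ℂ) (i : X) (s : ℂ), (s ≠ 0 → r < ‖c‖ ∧ i ∈ Z) →
    c • z = complexify A *ᵥ z + Pi.single i s → (∀ y ∈ Y, z y = 0) → (∀ x ∉ Z, z x = 0) → z = 0

open Classical in
/-- The system `A` enlarged by the cycle of `π` through `j`, all of whose links have the weight
`w`, and by a link of weight one from `j` to `i`. -/
noncomputable def cycleExtension (A : Matrix X X ℝ) (π : Equiv.Perm X) (w : ℝ) (i j : X) :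
    Matrix X X ℝ :=
  A + Matrix.of (fun a b => if π.SameCycle j a ∧ b = π.symm a then w else 0) + Matrix.single i j 1

open Classical in
lemma complexify_cycleExtension_mulVec (A : Matrix X X ℝ) (π : Equiv.Perm X) (w : ℝ) (i j : X)
    (z : X → ℂ) : complexify (cycleExtension A π w i j) *ᵥ z = complexify A *ᵥ z +
      (fun a => if π.SameCycle j a then (w : ℂ) * z (π.symm a) else 0) + Pi.single i (z j) := by
  rw [cycleExtension, complexify, Matrix.map_add _ (map_add _), Matrix.map_add _ (map_add _),
    Matrix.add_mulVec, Matrix.add_mulVec, Matrix.map_single]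
  congr 1
  · congr 1
    ext a
    by_cases ha : π.SameCycle j a <;> simp [Matrix.mulVec, dotProduct, ha, apply_ite Complex.ofReal]
  · simp [Matrix.single_mulVec, Pi.single]

section Extension

variable {A : Matrix X X ℝ} {R : X → X → Prop} {Y Z : Set X} {r w : ℝ} {π : Equiv.Perm X}
  {i j k : X} {c s : ℂ} {z : X → ℂ}

lemma IsObservableBlock.input_eq_zero (hA : IsObservableBlock A Y Z r)
    (hs : s ≠ 0 → r < ‖c‖ ∧ i ∈ Z) (heq : c • z = complexify A *ᵥ z + Pi.single i s)
    (hzY : ∀ y ∈ Y, z y = 0) (hzsupp : ∀ x ∉ Z, z x = 0) : s = 0 := by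
  rw [hA c z i s hs heq hzY hzsupp, smul_zero, Matrix.mulVec_zero, zero_add] at heq
  simpa using (congrFun heq i).symm

lemma IsObservableBlock.exit_eq_zero (hA : IsObservableBlock A Y Z r)
    (hK : ∀ a, π.SameCycle j a → a ∉ Z) (hi : i ∈ Z ∨ z j = 0) (hw : 0 < w) (hrw : r < w)
    (hs : s ≠ 0 → w < ‖c‖)
    (hcyc : ∀ a, π.SameCycle j a →
      c * z a = w * z (π.symm a) + (Pi.single k s : X → ℂ) a)
    (hblock : c • Z.indicator z =
      complexify A *ᵥ Z.indicator z + Pi.single i (z j) + Z.indicator (Pi.single k s))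
    (hzY : ∀ y ∈ Y, z y = 0) : z j = 0 := by
  by_contra hne
  have hresonance (hk : s ≠ 0 → ¬ π.SameCycle j k) : ‖c‖ = w := by
    have hunforced : ∀ a, π.SameCycle j a → c * z a = w * z (π.symm a) := fun a ha => by
      rw [hcyc a ha, Pi.single_apply, ite_eq_right_iff.2, add_zero]
      exact fun hak => by_contra fun hs => hk hs (hak ▸ ha)
    rw [norm_eq_of_cycle hunforced hne, Complex.norm_of_nonneg hw.le]
  have hkZ : s ≠ 0 → k ∉ Z := fun hs0 hk =>
    (hs hs0).ne' (hresonance fun _ h => hK k h hk)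
  have hrc : r < ‖c‖ := by
    rcases eq_or_ne s 0 with rfl | hs0
    · rwa [hresonance fun h => absurd rfl h]
    · exact hrw.trans (hs hs0)
  have hno_input : Z.indicator (Pi.single k s : X → ℂ) = 0 := by
    ext a
    by_cases ha : a ∈ Z
    · rw [Set.indicator_of_mem ha, Pi.single_apply, Pi.zero_apply, ite_eq_right_iff]
      exact fun hak => by_contra fun hs0 => hkZ hs0 (hak ▸ ha)
    · exact Set.indicator_of_notMem ha _
  rw [hno_input, add_zero] at hblock
  exact hne (hA.input_eq_zero (fun _ => ⟨hrc, hi.resolve_right hne⟩) hblock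
    (fun y hy => Set.indicator_apply_eq_zero.2 fun _ => hzY y hy)
    fun x hx => Set.indicator_of_notMem hx z)

lemma IsObservableBlock.eq_zero_of_cycle (hA : IsObservableBlock A Y Z r)
    (hK : ∀ a, π.SameCycle j a → a ∉ Z) (hw : 0 < w) (hrw : r < w)
    (hs : s ≠ 0 → w < ‖c‖ ∧ (k ∈ Z ∨ π.SameCycle j k))
    (hcyc : ∀ a, π.SameCycle j a →
      c * z a = w * z (π.symm a) + (Pi.single k s : X → ℂ) a)
    (hblock : c • Z.indicator z =
      complexify A *ᵥ Z.indicator z + Pi.single i (z j) + Z.indicator (Pi.single k s))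
    (hzY : ∀ y ∈ Y, z y = 0) (hzj : z j = 0) :
    (∀ a, π.SameCycle j a → z a = 0) ∧ Z.indicator z = 0 := by
  have hwC : (w : ℂ) ≠ 0 := Complex.ofReal_ne_zero.2 hw.ne'
  have hkZ : s ≠ 0 → k ∈ Z := fun hs0 => (hs hs0).2.resolve_right fun hk =>
    hs0 (input_eq_zero_of_cycle hcyc hwC (norm_pos_iff.1 (hw.trans (hs hs0).1)) hzj hk)
  have hinput : ∀ a, a ∉ Z → (Pi.single k s : X → ℂ) a = 0 := fun a ha => by
    rw [Pi.single_apply, ite_eq_right_iff]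
    exact fun hak => by_contra fun hs0 => ha (hak ▸ hkZ hs0)
  refine ⟨fun a ha => CyberSocial.eq_zero_of_cycle (c := c) (fun b hb => ?_) hwC hzj ha, ?_⟩
  · rw [hcyc b hb, hinput b (hK b hb), add_zero]
  · rw [hzj, Pi.single_zero, add_zero, Set.indicator_eq_self.2
      fun a ha => by_contra fun h => ha (hinput a h)] at hblock
    exact hA c _ k s (fun hs0 => ⟨hrw.trans (hs hs0).1, hkZ hs0⟩) hblock
      (fun y hy => Set.indicator_apply_eq_zero.2 fun _ => hzY y hy)
      fun x hx => Set.indicator_of_notMem hx z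

lemma IsObservableBlock.cycleExtension (hA : IsObservableBlock A Y Z r)
    (hsupp : IsSupportedBlock R A Y Z) (hK : ∀ a, π.SameCycle j a → a ∉ Z)
    (hi : i ∈ Z ∨ j ∈ Y) (hw : 0 < w) (hrw : r < w) :
    IsObservableBlock (cycleExtension A π w i j) Y (Z ∪ {a | π.SameCycle j a}) w := by
  intro c z k s hs heq hzY hzsupp
  rw [complexify_cycleExtension_mulVec] at heq
  have hi' : i ∈ Z ∨ z j = 0 := hi.imp_right (hzY j)
  have hlink : ∀ a, a ∉ Z → (Pi.single i (z j) : X → ℂ) a = 0 := fun a ha => by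
    rcases hi' with hi | hzj
    · exact Pi.single_eq_of_ne (fun h : a = i => ha (h ▸ hi)) _
    · rw [hzj, Pi.single_zero, Pi.zero_apply]
  have hcyc : ∀ a, π.SameCycle j a →
      c * z a = w * z (π.symm a) + (Pi.single k s : X → ℂ) a := fun a ha => by
    simpa [hsupp.mulVec_eq_zero_of_notMem z (hK a ha), ha, hlink a (hK a ha)] using congrFun heq a
  have hblock : c • Z.indicator z =
      complexify A *ᵥ Z.indicator z + Pi.single i (z j) + Z.indicator (Pi.single k s) := by
    rw [hsupp.mulVec_indicator]
    ext a
    by_cases ha : a ∈ Z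
    · simpa [ha, show ¬ π.SameCycle j a from fun h => hK a h ha] using congrFun heq a
    · simp [ha, hlink a ha, hsupp.mulVec_eq_zero_of_notMem z ha]
  have hzj := hA.exit_eq_zero hK hi' hw hrw (fun hs0 => (hs hs0).1) hcyc hblock hzY
  obtain ⟨hzK, hzZ⟩ := hA.eq_zero_of_cycle hK hw hrw hs hcyc hblock hzY hzj
  ext x
  by_cases hx : x ∈ Z
  · exact Set.indicator_apply_eq_zero.1 (congrFun hzZ x) hx
  · by_cases hxK : π.SameCycle j x
    · exact hzK x hxK
    · exact hzsupp x (not_or.2 ⟨hx, hxK⟩)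

lemma IsSupportedBlock.cycleExtension (hA : IsSupportedBlock R A Y Z)
    (hπ : ∀ a, a ∈ Y ∨ R (π a) a) (hi : i ∈ Z ∧ R i j ∨ j ∈ Y ∧ i = j) :
    IsSupportedBlock R (cycleExtension A π w i j) Y (Z ∪ {a | π.SameCycle j a}) := by
  intro a b hab
  by_cases hcycle : π.SameCycle j a ∧ b = π.symm a
  · obtain ⟨ha, rfl⟩ := hcycle
    exact ⟨.inr ha, .inr ha.symm_apply_right, by simpa using hπ (π.symm a)⟩
  · by_cases hlink : i = a ∧ j = b
    · obtain ⟨rfl, rfl⟩ := hlink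
      rcases hi with ⟨hi, hR⟩ | ⟨hj, rfl⟩
      · exact ⟨.inl hi, .inr (.refl π j), .inr hR⟩
      · exact ⟨.inr (.refl π _), .inr (.refl π _), .inl hj⟩
    · have hA0 : A a b ≠ 0 := by
        simpa [CyberSocial.cycleExtension, hcycle, Matrix.single_apply_of_ne _ _ _ _ _ hlink]
          using hab
      exact (hA a b hA0).imp .inl (.imp_left .inl)

end Extension

lemma exists_isObservableBlock_univ {R : X → X → Prop} {Y : Set X} {π : Equiv.Perm X}
    (hπ : ∀ j, j ∈ Y ∨ R (π j) j) (hpath : ∀ x, ∃ y ∈ Y, HasPath R x y) :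
    ∃ (A : Matrix X X ℝ) (r : ℝ), IsSupportedBlock R A Y Set.univ ∧
      IsObservableBlock A Y Set.univ r := by
  obtain ⟨Z, ⟨hZ, A, r, hsupp, hA⟩, hmax⟩ := Set.exists_max_image
    {Z : Set X | (∀ x, π x ∈ Z ↔ x ∈ Z) ∧ ∃ (A : Matrix X X ℝ) (r : ℝ), IsSupportedBlock R A Y Z ∧
      IsObservableBlock A Y Z r} Set.ncard (Set.toFinite _)
    ⟨∅, by simp, 0, 0, by simp [IsSupportedBlock], fun c z _ _ _ _ _ h => funext fun x => h x id⟩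
  suffices huniv : Z = Set.univ by
    subst huniv
    exact ⟨A, r, hsupp, hA⟩
  by_contra hne
  obtain ⟨x, hx⟩ := (Set.ne_univ_iff_exists_notMem Z).1 hne
  obtain ⟨j, hj, i, hi⟩ : ∃ j, j ∉ Z ∧ ∃ i, i ∈ Z ∧ R i j ∨ j ∈ Y ∧ i = j := by
    obtain ⟨y, hyY, hxy⟩ := hpath x
    induction hxy using Relation.ReflTransGen.head_induction_on with
    | refl => exact ⟨y, hx, y, .inr ⟨hyY, rfl⟩⟩
    | @head a b hab _ ih =>
      by_cases hb : b ∈ Z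
      · exact ⟨a, hx, b, .inl ⟨hb, hab⟩⟩
      · exact ih hb
  have hK : ∀ a, π.SameCycle j a → a ∉ Z := fun a ha =>
    of_sameCycle (p := (· ∉ Z)) ha hj fun b _ hb _ => mt (hZ b).1 hb
  have hle := hmax (Z ∪ {a | π.SameCycle j a})
    ⟨fun x => or_congr (hZ x) Equiv.Perm.sameCycle_apply_right, _, _,
      hsupp.cycleExtension hπ hi, hA.cycleExtension hsupp hK (hi.imp And.left And.left)
        (w := |r| + 1) (by positivity) (by linarith [le_abs_self r])⟩
  refine hle.not_gt (Set.ncard_lt_ncard ⟨Set.subset_union_left, fun h => hj (h ?_)⟩)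
  exact .inr (.refl π j)

end ObservableBlock

lemma exists_noHiddenMode {X : Type*} [Fintype X] {R : X → X → Prop} {Y : Set X} {π : Equiv.Perm X}
    (hπ : ∀ j, j ∈ Y ∨ R (π j) j) (hpath : ∀ x, ∃ y ∈ Y, HasPath R x y) :
    ∃ a : X → X → ℝ, NoHiddenMode (systemMatrix R a) Y := by
  classical
  obtain ⟨A, r, hsupp, hA⟩ := exists_isObservableBlock_univ hπ hpath
  refine ⟨A, fun c z hz hzY => ?_⟩
  rcases isEmpty_or_nonempty X with _ | ⟨⟨x⟩⟩
  · exact Subsingleton.elim _ _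
  -- the two matrices differ only in the columns in `Y`, which do not act on `z`
  have hcolumns : complexify A *ᵥ z = complexify (systemMatrix R A) *ᵥ z := by
    ext a
    refine Finset.sum_congr rfl fun b _ => ?_
    by_cases hb : b ∈ Y
    · rw [hzY b hb, mul_zero, mul_zero]
    · by_cases hR : R a b
      · simp [systemMatrix, hR]
      · simp [systemMatrix, hR, by_contra fun h : A a b ≠ 0 => (hsupp a b h).2.2.elim hb hR]
  exact hA c z x 0 (fun h => absurd rfl h) (by rw [hcolumns, hz, Pi.single_zero, add_zero]) hzY
    fun x hx => absurd trivial hx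

end SpanningCycles

section StronglyConnectedNetworks

lemma exists_pairwise_one_le_abs_sub (ι : Type*) [Finite ι] :
    ∃ d : ι → ℝ, (∀ k, 1 ≤ d k) ∧ Pairwise fun k l => 1 ≤ |d k - d l| := by
  refine ⟨fun k => (Finite.equivFin ι k : ℕ) + 1, fun k => by simp, fun k l hkl => ?_⟩
  have hne : ((Finite.equivFin ι k : ℕ) : ℤ) ≠ (Finite.equivFin ι l : ℕ) := fun h =>
    hkl ((Finite.equivFin ι).injective (Fin.val_injective (Int.ofNat_injective h)))
  simp only [add_sub_add_right_eq_sub]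
  exact_mod_cast Int.one_le_abs (sub_ne_zero.2 hne)

lemma exists_isRoot_of_eval_mul_eval_neg {p : Polynomial ℝ} {a b : ℝ} (hab : a ≤ b)
    (h : p.eval a * p.eval b < 0) : ∃ x ∈ Set.Icc a b, p.IsRoot x := by
  have hzero : (0 : ℝ) ∈ Set.uIcc (p.eval a) (p.eval b) := by
    rw [Set.mem_uIcc]
    exact (mul_neg_iff.1 h).symm.imp (fun h => ⟨h.1.le, h.2.le⟩) fun h => ⟨h.2.le, h.1.le⟩
  rw [← Set.uIcc_of_le hab]
  exact intermediate_value_uIcc p.continuous.continuousOn hzero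

lemma continuous_systemMatrix {X : Type*} (E : X → X → Prop) : Continuous (systemMatrix E) :=
  continuous_matrix fun x y => by
    by_cases h : E x y
    · simpa only [systemMatrix, Matrix.of_apply, if_pos h] using continuous_apply_apply x y
    · simpa only [systemMatrix, Matrix.of_apply, if_neg h] using continuous_const

variable {ι : Type*} [Fintype ι] [DecidableEq ι]

/-- The weights for which the characteristic polynomial of the weight matrix changes sign around
`d k`, for every `k`. -/
def signChangeSet (G : ι → ι → Prop) (d : ι → ℝ) (δ : ℝ) : Set (ι → ι → ℝ) :=
  {w | ∀ k, (systemMatrix G w).charpoly.eval (d k - δ) *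
    (systemMatrix G w).charpoly.eval (d k + δ) < 0}

lemma isOpen_signChangeSet (G : ι → ι → Prop) (d : ι → ℝ) (δ : ℝ) :
    IsOpen (signChangeSet G d δ) := by
  simp only [signChangeSet, Set.ofPred_forall, Matrix.eval_charpoly]
  have hdet : ∀ x : ℝ, Continuous fun w => (Matrix.scalar ι x - systemMatrix G w).det := fun x =>
    (continuous_const.sub (continuous_systemMatrix G)).matrix_det
  exact isOpen_iInter_of_finite fun k => isOpen_lt ((hdet _).mul (hdet _)) continuous_const

lemma diagonal_mem_signChangeSet {G : ι → ι → Prop} (hG : ∀ i, G i i) {d : ι → ℝ} {δ : ℝ}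
    (hδ : 0 < δ) (hd : Pairwise fun k l => δ < |d k - d l|) :
    Matrix.diagonal d ∈ signChangeSet G d δ := by
  have hdiag : systemMatrix G (Matrix.diagonal d) = Matrix.diagonal d := by
    ext i j
    rcases eq_or_ne i j with rfl | hij
    · simp [systemMatrix, hG]
    · simp [systemMatrix, hij]
  intro k
  have hprod : ∀ l ≠ k, 0 < (d k - δ - d l) * (d k + δ - d l) := fun l hl => by
    nlinarith [sq_lt_sq.2 ((abs_of_pos hδ).trans_lt (hd hl.symm))]
  simp only [hdiag, Matrix.eval_charpoly, Matrix.scalar_apply, Matrix.diagonal_sub,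
    Matrix.det_diagonal, ← Finset.prod_mul_distrib]
  rw [← Finset.mul_prod_erase _ _ (Finset.mem_univ k)]
  exact mul_neg_of_neg_of_pos (by nlinarith)
    (Finset.prod_pos fun l hl => hprod l (Finset.ne_of_mem_erase hl))

lemma exists_eigenvector_matrix {B : Matrix ι ι ℝ} {μ : ι → ℝ} (hμ : Function.Injective μ)
    (hroot : ∀ k, B.charpoly.IsRoot (μ k)) (hB : ∀ i, NoHiddenMode B {i}) :
    ∃ Q : Matrix ι ι ℝ, IsUnit Q ∧ (∀ i k, Q i k ≠ 0) ∧ B * Q = Q * Matrix.diagonal μ := by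
  have heig : ∀ k, ∃ v, Module.End.HasEigenvector (Matrix.toLin' B) (μ k) v := fun k =>
    (Module.End.hasEigenvalue_iff_isRoot_charpoly _ _).2
      (by rw [Matrix.charpoly_toLin']; exact hroot k) |>.exists_hasEigenvector
  choose v hv using heig
  have hBv : ∀ k, B *ᵥ v k = μ k • v k := fun k => (hv k).apply_eq_smul
  refine ⟨(Matrix.of v)ᵀ, ?_, fun i k hik => (hv k).2 ?_, ?_⟩
  · rw [← Matrix.linearIndependent_cols_iff_isUnit]
    exact Module.End.eigenvectors_linearIndependent' _ μ hμ v hv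
  · have h0 := hB i (μ k) (fun j => (v k j : ℂ))
      (by ext j; rw [complexify_mulVec_ofReal, hBv]; simp) (by simpa using hik)
    exact funext fun j => Complex.ofReal_eq_zero.1 (congrFun h0 j)
  · ext i k
    rw [Matrix.mul_diagonal, mul_comm]
    exact congrFun (hBv k) i

lemma exists_diagonalizable_systemMatrix {G : ι → ι → Prop} (hdiag : ∀ i, G i i)
    (hG : ∀ i j, HasPath G i j) : ∃ (w Q : Matrix ι ι ℝ) (μ : ι → ℝ), IsUnit Q ∧
      (∀ i k, Q i k ≠ 0) ∧ Function.Injective μ ∧ (∀ k, 0 < μ k) ∧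
      systemMatrix G w * Q = Q * Matrix.diagonal μ := by
  obtain ⟨d, hd1, hd⟩ := exists_pairwise_one_le_abs_sub ι
  have hgeneric : ∀ᵐ w : ι → ι → ℝ, ∀ i, NoHiddenMode (systemMatrix G w) {i} := by
    refine ae_all_iff.2 fun i => ?_
    obtain ⟨w₀, hw₀⟩ := exists_noHiddenMode (R := G) (Y := {i}) (π := 1)
      (fun j => .inr (hdiag j)) fun x => ⟨i, rfl, hG x i⟩
    exact ae_noHiddenMode (HasAnalyticEntries.systemMatrix
      (analyticOnNhd_apply_apply fun _ _ => analyticAt_id) G) w₀ hw₀ volume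
  obtain ⟨w, hsign, hw⟩ := (Measure.dense_of_ae hgeneric).inter_open_nonempty _
    (isOpen_signChangeSet G d (1 / 3)) ⟨_, diagonal_mem_signChangeSet hdiag (by norm_num)
      fun k l hkl => by linarith [hd hkl]⟩
  have hroots : ∀ k, ∃ x ∈ Set.Icc (d k - 1 / 3) (d k + 1 / 3),
      (systemMatrix G w).charpoly.IsRoot x := fun k =>
    exists_isRoot_of_eval_mul_eval_neg (by linarith) (hsign k)
  choose μ hμ hroot using hroots
  have hinj : Function.Injective μ := fun k l hkl => by
    by_contra hne
    refine (hd hne).not_gt (abs_lt.2 ?_)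
    constructor <;> linarith [(hμ k).1, (hμ k).2, (hμ l).1, (hμ l).2]
  obtain ⟨Q, hQ, hQ0, hBQ⟩ := exists_eigenvector_matrix hinj hroot hw
  exact ⟨w, Q, μ, hQ, hQ0, hinj, fun k => by linarith [(hμ k).1, hd1 k], hBQ⟩

/-- The rows of `W` sum to one and the off-diagonal entries of `W` are supported on the links of
`G`. Unlike for the weights of the agents, no sign is required and an entry on a link or on the
diagonal may vanish. -/
def IsAdmissibleWeight (G : ι → ι → Prop) (W : Matrix ι ι ℝ) : Prop :=
  (∀ i j, i ≠ j → W i j ≠ 0 → G i j) ∧ W *ᵥ 1 = 1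

lemma IsAdmissibleWeight.one_sub_smul_one_add_smul {G : ι → ι → Prop} {W : Matrix ι ι ℝ}
    (hW : IsAdmissibleWeight G W) (ε : ℝ) :
    IsAdmissibleWeight G ((1 - ε) • (1 : Matrix ι ι ℝ) + ε • W) := by
  refine ⟨fun i j hij h => hW.1 i j hij fun h0 => h ?_, ?_⟩
  · simp [hij, h0]
  · rw [Matrix.add_mulVec, Matrix.smul_mulVec, Matrix.smul_mulVec, Matrix.one_mulVec, hW.2,
      ← add_smul, sub_add_cancel, one_smul]

-- Conjugation by an eigenvector without zero entries turns it into the constant vector.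
lemma exists_diagonalizable_isAdmissibleWeight [Nonempty ι] {G : ι → ι → Prop}
    (hG : ∀ i j, HasPath G i j) : ∃ (W Q : Matrix ι ι ℝ) (μ : ι → ℝ), IsAdmissibleWeight G W ∧
      IsUnit Q ∧ (∀ i k, Q i k ≠ 0) ∧ Function.Injective μ ∧ W * Q = Q * Matrix.diagonal μ := by
  obtain ⟨b, Q, μ, hQ, hQ0, hμ, hμ0, hBQ⟩ := exists_diagonalizable_systemMatrix
    (G := fun i j => i = j ∨ G i j) (fun _ => .inl rfl) fun i j =>
      Relation.ReflTransGen.mono (fun _ _ => Or.inr) i j (hG i j)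
  set B := systemMatrix (fun i j => i = j ∨ G i j) b
  obtain ⟨k⟩ := ‹Nonempty ι›
  set r : ι → ℝ := fun i => Q i k
  have hBr : B *ᵥ r = μ k • r := funext fun i => by
    have h := congrFun (congrFun hBQ i) k
    rw [Matrix.mul_diagonal, mul_comm] at h
    exact h
  have hDD : Matrix.diagonal r * Matrix.diagonal r⁻¹ = 1 := by
    simp [Matrix.diagonal_mul_diagonal, r, hQ0]
  refine ⟨(μ k)⁻¹ • (Matrix.diagonal r⁻¹ * B * Matrix.diagonal r), Matrix.diagonal r⁻¹ * Q,
    fun l => (μ k)⁻¹ * μ l, ⟨fun i j hij h => ?_, ?_⟩, ?_, fun i l => ?_, ?_, ?_⟩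
  · refine by_contra fun hGij => h ?_
    simp [B, systemMatrix, hij, hGij, Matrix.mul_diagonal, Matrix.diagonal_mul]
  · have h1 : Matrix.diagonal r *ᵥ 1 = r := by ext; simp [Matrix.mulVec_diagonal]
    rw [Matrix.smul_mulVec, ← Matrix.mulVec_mulVec, ← Matrix.mulVec_mulVec, h1, hBr,
      Matrix.mulVec_smul, smul_smul, inv_mul_cancel₀ (hμ0 k).ne', one_smul]
    ext i
    simp [Matrix.mulVec_diagonal, r, hQ0]
  · exact (IsUnit.of_mul_eq_one_right _ hDD).mul hQ
  · simp [Matrix.diagonal_mul, r, hQ0]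
  · exact (mul_right_injective₀ (inv_ne_zero (hμ0 k).ne')).comp hμ
  · have hsmul : Matrix.diagonal (fun l => (μ k)⁻¹ * μ l) = (μ k)⁻¹ • Matrix.diagonal μ := by
      rw [← Matrix.diagonal_smul]; rfl
    rw [hsmul, Matrix.smul_mul, Matrix.mul_smul, Matrix.mul_assoc, ← Matrix.mul_assoc _ _ Q,
      hDD, Matrix.one_mul, Matrix.mul_assoc, hBQ, Matrix.mul_assoc]

end StronglyConnectedNetworks

section KroneckerProduct

lemma eventually_cofinite_add_mul_ne_zero {a b : ℂ} (hab : a = 0 → b ≠ 0) :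
    ∀ᶠ ε : ℝ in Filter.cofinite, a + b * ε ≠ 0 := by
  rcases eq_or_ne b 0 with rfl | hb
  · have ha : a ≠ 0 := fun h => hab h rfl
    exact .of_forall fun ε => by simpa using ha
  · have hsub : {ε : ℝ | ¬ a + b * ε ≠ 0}.Subsingleton := fun ε hε ε' hε' =>
      Complex.ofReal_injective (mul_left_cancel₀ hb
        (add_left_cancel ((not_not.1 hε).trans (not_not.1 hε').symm)))
    exact Filter.eventually_cofinite.2 hsub.finite

lemma exists_separating_parameter {ι : Type*} [Finite ι] {μ : ι → ℝ} (hμ : Function.Injective μ)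
    {Λ : Set ℂ} (hΛ : Λ.Finite) : ∃ ε : ℝ, (∀ k, 1 - ε + ε * μ k ≠ 0) ∧
      ∀ α ∈ Λ, α ≠ 0 → ∀ β ∈ Λ, ∀ k l, k ≠ l →
        α * (1 - ε + ε * μ k : ℝ) ≠ β * (1 - ε + ε * μ l : ℝ) := by
  refine Filter.Eventually.exists (f := Filter.cofinite) (.and ?_ ?_)
  · refine Filter.eventually_all.2 fun k => ?_
    filter_upwards [eventually_cofinite_add_mul_ne_zero (a := 1) (b := μ k - 1) (by simp)]
      with ε hε h
    exact hε (by rw [← Complex.ofReal_zero, ← h]; push_cast; ring)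
  · simp only [Filter.eventually_all_finite hΛ, Filter.eventually_all]
    intro α _ hα β _ k l hkl
    have hcoeff : α - β = 0 → α * (μ k - 1) - β * (μ l - 1) ≠ 0 := fun h h' => hkl <| hμ <| by
      obtain rfl := sub_eq_zero.1 h
      rw [← mul_sub, mul_eq_zero, or_iff_right hα, sub_sub_sub_cancel_right, sub_eq_zero] at h'
      exact_mod_cast h'
    filter_upwards [eventually_cofinite_add_mul_ne_zero hcoeff] with ε hε h
    refine hε ?_
    push_cast at h
    linear_combination h

section ModalDecomposition

variable {ι X : Type*} [Fintype ι] [Fintype X]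

lemma mul_mul_transpose_eq_smul_of_kronecker_mulVec_vec {A : Matrix X X ℝ} {W : Matrix ι ι ℝ}
    {c : ℂ} {Z : Matrix X ι ℂ} (h : complexify (W ⊗ₖ A) *ᵥ Z.vec = c • Z.vec) :
    complexify A * Z * (complexify W)ᵀ = c • Z := by
  rw [← Matrix.vec_inj, Matrix.vec_smul, ← h, ← Matrix.kronecker_mulVec_vec]
  congr 1
  ext
  simp [Matrix.kroneckerMap_apply]

variable [DecidableEq ι]

lemma complexify_mul_eq_mul_diagonal {W Q : Matrix ι ι ℝ} {ν : ι → ℝ}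
    (h : W * Q = Q * Matrix.diagonal ν) :
    complexify W * complexify Q = complexify Q * Matrix.diagonal fun k => (ν k : ℂ) := by
  simpa [Matrix.map_mul, Matrix.diagonal_map, Function.comp_def] using congrArg complexify h

lemma exists_modal_decomposition {R : Type*} [CommRing R] {A : Matrix X X R} {W Q : Matrix ι ι R}
    {ν : ι → R} (hQ : IsUnit Q) (hWQ : W * Q = Q * Matrix.diagonal ν) {c : R} {Z : Matrix X ι R}
    (hZ : A * Z * Wᵀ = c • Z) :
    ∃ Y : Matrix X ι R, Z = Y * Qᵀ ∧ ∀ k, ν k • (A *ᵥ Y.col k) = c • Y.col k := by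
  have hQt : IsUnit Qᵀ.det := by rwa [Matrix.det_transpose, ← Matrix.isUnit_iff_isUnit_det]
  have hZY : Z = Z * (Qᵀ)⁻¹ * Qᵀ := (Matrix.nonsing_inv_mul_cancel_right _ _ hQt).symm
  refine ⟨Z * (Qᵀ)⁻¹, hZY, fun k => ?_⟩
  set Y := Z * (Qᵀ)⁻¹
  have hWQt : Qᵀ * Wᵀ = Matrix.diagonal ν * Qᵀ := by
    rw [← Matrix.transpose_mul, hWQ, Matrix.transpose_mul, Matrix.diagonal_transpose]
  have hY : A * Y * Matrix.diagonal ν = c • Y := by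
    refine Matrix.mul_left_injective_of_inv Qᵀ _ (Matrix.mul_nonsing_inv _ hQt) ?_
    calc A * Y * Matrix.diagonal ν * Qᵀ = A * (Y * Qᵀ) * Wᵀ := by
          simp only [Matrix.mul_assoc, hWQt]
      _ = c • Y * Qᵀ := by rw [← hZY, hZ, Matrix.smul_mul, ← hZY]
  ext x
  have h := congrFun (congrFun hY x) k
  rw [Matrix.mul_diagonal, mul_comm] at h
  exact h

variable [DecidableEq X]

lemma mem_spectrum_of_mulVec_eq_smul {K : Type*} [Field K] {A : Matrix X X K} {c : K} {z : X → K}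
    (h : A *ᵥ z = c • z) (hz : z ≠ 0) : c ∈ spectrum K A := by
  rw [← Matrix.spectrum_toLin']
  exact (Module.End.hasEigenvalue_of_hasEigenvector
    (x := z) ⟨Module.End.mem_eigenspace_iff.2 h, hz⟩).mem_spectrum

-- At a nonzero eigenvalue the separation of the products leaves a single mode; at zero every mode
-- lies in the kernel of `A`.
lemma noHiddenMode_kronecker {A : Matrix X X ℝ} {W Q : Matrix ι ι ℝ} {ν : ι → ℝ} {M : ι → Set X}
    (hQ : IsUnit Q) (hQ0 : ∀ i k, Q i k ≠ 0) (hWQ : W * Q = Q * Matrix.diagonal ν)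
    (hν : ∀ k, ν k ≠ 0)
    (hsep : ∀ α ∈ spectrum ℂ (complexify A), α ≠ 0 → ∀ β ∈ spectrum ℂ (complexify A),
      ∀ k l, k ≠ l → α * ν k ≠ β * ν l)
    (hker : ∀ i z, complexify A *ᵥ z = 0 → (∀ x ∈ M i, z x = 0) → z = 0)
    (hno : NoHiddenMode A (⋃ i, M i)) : NoHiddenMode (W ⊗ₖ A) {q | q.2 ∈ M q.1} := by
  intro c z hz hzM
  obtain ⟨Z, rfl⟩ := Matrix.vec_bijective.surjective z
  obtain ⟨Y, rfl, hY⟩ := exists_modal_decomposition (hQ.map Complex.ofRealHom.mapMatrix)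
    (complexify_mul_eq_mul_diagonal hWQ) (mul_mul_transpose_eq_smul_of_kronecker_mulVec_vec hz)
  have hνℂ : ∀ k, (ν k : ℂ) ≠ 0 := fun k => Complex.ofReal_ne_zero.2 (hν k)
  rw [Matrix.vec_eq_zero_iff]
  rcases eq_or_ne c 0 with rfl | hc
  · have hAY : complexify A * Y = 0 := Matrix.ext fun x k =>
      congrFun ((smul_eq_zero.1 ((hY k).trans (zero_smul ℂ _))).resolve_left (hνℂ k)) x
    have hAZ : complexify A * (Y * (complexify Q)ᵀ) = 0 := by
      rw [← Matrix.mul_assoc, hAY, Matrix.zero_mul]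
    have hcol : ∀ i, (Y * (complexify Q)ᵀ).col i = 0 := fun i =>
      hker i _ (funext fun x => congrFun (congrFun hAZ x) i) fun x hx => hzM (i, x) hx
    exact Matrix.ext fun x i => congrFun (hcol i) x
  · have hmode : ∀ k, complexify A *ᵥ Y.col k = (c / ν k) • Y.col k := fun k => by
      rw [div_eq_inv_mul, mul_smul, ← hY k, inv_smul_smul₀ (hνℂ k)]
    have hsingle : ∀ k l, k ≠ l → Y.col k ≠ 0 → Y.col l = 0 := fun k l hkl hk => by
      by_contra hl
      exact hsep _ (mem_spectrum_of_mulVec_eq_smul (hmode k) hk) (div_ne_zero hc (hνℂ k)) _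
        (mem_spectrum_of_mulVec_eq_smul (hmode l) hl) k l hkl
        (by rw [div_mul_cancel₀ _ (hνℂ k), div_mul_cancel₀ _ (hνℂ l)])
    have hcol : ∀ k, Y.col k = 0 := fun k => by
      by_contra hk
      refine hk (hno _ _ (hmode k) fun x hx => ?_)
      obtain ⟨i, hi⟩ := Set.mem_iUnion.1 hx
      have h : ∑ l, Y x l * (Q i l : ℂ) = 0 := hzM (i, x) hi
      rw [Fintype.sum_eq_single k fun l hl => by
        rw [show Y x l = 0 from congrFun (hsingle k l hl.symm hk) x, zero_mul]] at h
      exact (mul_eq_zero.1 h).resolve_right (Complex.ofReal_ne_zero.2 (hQ0 i k))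
    rw [show Y = 0 from Matrix.ext fun x k => congrFun (hcol k) x, Matrix.zero_mul]

end ModalDecomposition

lemma exists_noHiddenMode_kronecker_of_forall_hasPath {ι X : Type*} [Fintype ι] [Nonempty ι]
    [Fintype X] {G : ι → ι → Prop}
    (hG : ∀ i j, HasPath G i j) {A : Matrix X X ℝ} {M : ι → Set X}
    (hker : ∀ i z, complexify A *ᵥ z = 0 → (∀ x ∈ M i, z x = 0) → z = 0)
    (hno : NoHiddenMode A (⋃ i, M i)) :
    ∃ W, IsAdmissibleWeight G W ∧ NoHiddenMode (W ⊗ₖ A) {q | q.2 ∈ M q.1} := by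
  classical
  obtain ⟨W, Q, μ, hW, hQ, hQ0, hμ, hWQ⟩ := exists_diagonalizable_isAdmissibleWeight hG
  obtain ⟨ε, hε, hsep⟩ := exists_separating_parameter hμ (Matrix.finite_spectrum (complexify A))
  refine ⟨_, hW.one_sub_smul_one_add_smul ε, noHiddenMode_kronecker hQ hQ0 ?_ hε hsep hker hno⟩
  ext i k
  rw [Matrix.add_mul, Matrix.smul_mul, Matrix.smul_mul, Matrix.one_mul, hWQ]
  simp only [Matrix.add_apply, Matrix.smul_apply, Matrix.mul_diagonal, smul_eq_mul]
  ring

end KroneckerProduct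

section Components

lemma NoHiddenMode.comp_eq_zero {κ m : Type*} [Fintype κ] [Fintype m] {F : Matrix m m ℝ}
    {f : κ → m} (hf : Function.Injective f) (hF : ∀ a, ∀ b ∉ Set.range f, F (f a) b = 0)
    {Y : Set m} (h : NoHiddenMode (F.submatrix f f) (f ⁻¹' Y)) {c : ℂ} {z : m → ℂ}
    (hz : complexify F *ᵥ z = c • z) (hzY : ∀ y ∈ Y, z y = 0) : z ∘ f = 0 := by
  refine h c _ (funext fun a => ?_) fun y hy => hzY _ hy
  refine .trans ?_ (congrFun hz (f a))
  refine Fintype.sum_of_injective f hf _ _ (fun b hb => ?_) fun b => rfl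
  simp [hF a b hb]

/-- The setoid whose classes are the strongly connected components. -/
def sccSetoid {ι : Type*} (G : ι → ι → Prop) : Setoid ι where
  r i j := HasPath G i j ∧ HasPath G j i
  iseqv := ⟨fun _ => ⟨.refl, .refl⟩, And.symm, fun h h' => ⟨h.1.trans h'.1, h'.2.trans h.2⟩⟩

/-- The nodes of the strongly connected component `q`. -/
abbrev ComponentNode {ι : Type*} (G : ι → ι → Prop) (q : Quotient (sccSetoid G)) : Type _ :=
  {i // Quotient.mk (sccSetoid G) i = q}

lemma hasPath_componentNode {ι : Type*} (G : ι → ι → Prop) {q : Quotient (sccSetoid G)}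
    (i j : ComponentNode G q) : HasPath (fun a b : ComponentNode G q => G a b) i j := by
  obtain ⟨i, rfl⟩ := i
  obtain ⟨j, hj⟩ := j
  have hij : HasPath G i j := (Quotient.exact hj).2
  induction hij with
  | refl => exact .refl
  | @tail b c hib hcb ih =>
    have hb : Quotient.mk (sccSetoid G) b = Quotient.mk _ i :=
      Quotient.sound ⟨.head hcb (Quotient.exact hj).1, hib⟩
    exact .tail (ih hb) hcb

variable {ι κ : Type*} [DecidableEq κ] {f : ι → κ}

/-- The matrix without entries between different fibers of `f`, with given blocks on the
fibers. -/
def fiberBlockMatrix (w : ∀ q, Matrix {i // f i = q} {i // f i = q} ℝ) : Matrix ι ι ℝ :=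
  Matrix.of fun i j => if h : f j = f i then w (f i) ⟨i, rfl⟩ ⟨j, h⟩ else 0

lemma fiberBlockMatrix_apply (w : ∀ q, Matrix {i // f i = q} {i // f i = q} ℝ) {q : κ}
    (a b : {i // f i = q}) : fiberBlockMatrix w a b = w q a b := by
  obtain ⟨a, rfl⟩ := a
  exact dif_pos b.2

lemma fiberBlockMatrix_apply_ne (w : ∀ q, Matrix {i // f i = q} {i // f i = q} ℝ) {i j : ι}
    (hij : f j ≠ f i) : fiberBlockMatrix w i j = 0 :=
  dif_neg hij

variable [Fintype ι] {G : ι → ι → Prop}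
  {w : ∀ q, Matrix {i // f i = q} {i // f i = q} ℝ}

lemma isAdmissibleWeight_fiberBlockMatrix
    (hw : ∀ q, IsAdmissibleWeight (fun a b : {i // f i = q} => G a b) (w q)) :
    IsAdmissibleWeight G (fiberBlockMatrix w) := by
  refine ⟨fun i j hij h => ?_, funext fun i => ?_⟩
  · have hf : f j = f i := by_contra fun hf => h (fiberBlockMatrix_apply_ne w hf)
    refine (hw (f i)).1 ⟨i, rfl⟩ ⟨j, hf⟩ (by simpa using hij) ?_
    rwa [← fiberBlockMatrix_apply w]
  · refine .trans (.symm ?_) (congrFun (hw (f i)).2 ⟨i, rfl⟩)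
    refine Fintype.sum_of_injective Subtype.val Subtype.val_injective _ _ (fun j hj => ?_)
      fun b => ?_
    · have hne : f j ≠ f i := fun h => hj ⟨⟨j, h⟩, rfl⟩
      exact (congrArg (· * (1 : ℝ)) (fiberBlockMatrix_apply_ne w hne)).trans (zero_mul _)
    · exact congrArg (· * (1 : ℝ)) (fiberBlockMatrix_apply w ⟨i, rfl⟩ b).symm

variable {X : Type*} [Fintype X] {A : Matrix X X ℝ} {M : ι → Set X}

lemma noHiddenMode_fiberBlockMatrix_kronecker
    (hw : ∀ q, NoHiddenMode (w q ⊗ₖ A) {y | y.2 ∈ M y.1}) :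
    NoHiddenMode (fiberBlockMatrix w ⊗ₖ A) {y | y.2 ∈ M y.1} := by
  refine fun c z hz hzM => funext fun ⟨i, x⟩ => ?_
  set e : {j // f j = f i} × X → ι × X := Prod.map Subtype.val id
  have he : Function.Injective e := Subtype.val_injective.prodMap Function.injective_id
  have hblock : (fiberBlockMatrix w ⊗ₖ A).submatrix e e = w (f i) ⊗ₖ A := by
    ext a b
    exact congrArg (· * A a.2 b.2) (fiberBlockMatrix_apply w a.1 b.1)
  refine congrFun (NoHiddenMode.comp_eq_zero he ?_ (hblock ▸ hw (f i)) hz hzM) (⟨i, rfl⟩, x)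
  intro a b hb
  have hne : f b.1 ≠ f a.1 := fun h => hb ⟨(⟨b.1, h.trans a.1.2⟩, b.2), rfl⟩
  exact (congrArg (· * A a.2 b.2) (fiberBlockMatrix_apply_ne w hne)).trans (zero_mul _)

lemma exists_noHiddenMode_kronecker
    (hker : ∀ i z, complexify A *ᵥ z = 0 → (∀ x ∈ M i, z x = 0) → z = 0)
    (hno : ∀ i, NoHiddenMode A (⋃ j ∈ {j | HasPath G i j ∧ HasPath G j i}, M j)) :
    ∃ W, IsAdmissibleWeight G W ∧ NoHiddenMode (W ⊗ₖ A) {q | q.2 ∈ M q.1} := by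
  classical
  have hblock : ∀ q, ∃ w : Matrix (ComponentNode G q) (ComponentNode G q) ℝ,
      IsAdmissibleWeight (fun i j : ComponentNode G q => G i j) w ∧
        NoHiddenMode (w ⊗ₖ A) {y | y.2 ∈ M y.1} := by
    intro q
    obtain ⟨i, rfl⟩ := Quotient.exists_rep q
    have : Nonempty (ComponentNode G (Quotient.mk _ i)) := ⟨⟨i, rfl⟩⟩
    refine exists_noHiddenMode_kronecker_of_forall_hasPath (hasPath_componentNode G)
      (fun j => hker j) ((hno i).mono (Set.iUnion₂_subset fun j hj => ?_))
    exact Set.subset_iUnion (fun j : ComponentNode G (Quotient.mk _ i) => M j)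
      ⟨j, Quotient.sound hj.symm⟩
  choose w hw hwM using hblock
  exact ⟨fiberBlockMatrix w, isAdmissibleWeight_fiberBlockMatrix hw,
    noHiddenMode_fiberBlockMatrix_kronecker hwM⟩

end Components

section GenericKernel

variable {X : Type*} [Fintype X] {E : X → X → Prop} {π : Equiv.Perm X}

lemma ae_det_systemMatrix_ne_zero [DecidableEq X] (hπ : ∀ j, E (π j) j) :
    ∀ᵐ a : X → X → ℝ, (systemMatrix E a).det ≠ 0 := by
  have hpattern : systemMatrix E (Equiv.Perm.permMatrix ℝ π.symm) =
      Equiv.Perm.permMatrix ℝ π.symm := by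
    ext i j
    rcases eq_or_ne (π.symm i) j with rfl | hij
    · have hi : E i (π.symm i) := by simpa using hπ (π.symm i)
      simp [systemMatrix, hi]
    · simp [systemMatrix, Equiv.Perm.permMatrix, PEquiv.toMatrix_apply, hij]
  have hanalytic : HasAnalyticEntries fun a : X → X → ℝ => systemMatrix E a :=
    HasAnalyticEntries.systemMatrix (analyticOnNhd_apply_apply fun _ _ => analyticAt_id) E
  refine ae_ne_zero_of_analyticOnNhd hanalytic.det (Equiv.Perm.permMatrix ℝ π.symm) ?_ volume
  rw [hpattern, Matrix.det_permutation]
  exact_mod_cast (Equiv.Perm.sign π.symm).ne_zero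

lemma ae_ker_systemMatrix_eq_zero {Y : Set X} (hπ : ∀ j, j ∈ Y ∨ E (π j) j) :
    ∀ᵐ a : X → X → ℝ, ∀ z, complexify (systemMatrix E a) *ᵥ z = 0 →
      (∀ x ∈ Y, z x = 0) → z = 0 := by
  classical
  set E' : X → X → Prop := fun i j => j ∈ Y ∨ E i j
  filter_upwards [ae_det_systemMatrix_ne_zero (E := E') hπ] with a ha z hz hzY
  refine Matrix.eq_zero_of_mulVec_eq_zero (M := complexify (systemMatrix E' a)) ?_
    (.trans (funext fun i => Finset.sum_congr rfl fun j _ => ?_) hz)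
  · exact (Complex.ofRealHom.map_det _).symm.trans_ne (Complex.ofReal_ne_zero.2 ha)
  · by_cases hj : j ∈ Y
    · rw [hzY j hj, mul_zero, mul_zero]
    · by_cases hij : E i j <;> simp [systemMatrix, E', hj, hij]

end GenericKernel

section NetworkedSystem

namespace HasAnalyticEntries

variable {V : Type*} [NormedAddCommGroup V] [NormedSpace ℝ V] {ι X : Type*}

lemma kronecker {F : V → Matrix ι ι ℝ} {G : V → Matrix X X ℝ} (hF : HasAnalyticEntries F)
    (hG : HasAnalyticEntries G) : HasAnalyticEntries fun θ => F θ ⊗ₖ G θ :=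
  fun a b => (hF a.1 b.1).mul (hG a.2 b.2)

lemma measurementMatrix {p : ι → ℕ} {h : V → (i : ι) → Fin (p i) → ℝ}
    (hh : ∀ i r, AnalyticOnNhd ℝ (fun θ => h θ i r) Set.univ) (s : (i : ι) → Fin (p i) → X)
    (i : ι) : HasAnalyticEntries fun θ => measurementMatrix s (h θ) i := fun r x => by
  by_cases hx : x = s i r
  · simpa only [CyberSocial.measurementMatrix, Matrix.of_apply, if_pos hx] using hh i r
  · simpa only [CyberSocial.measurementMatrix, Matrix.of_apply, if_neg hx]
      using analyticOnNhd_const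

variable [Fintype ι]

lemma DH {p : ι → ℕ} {H : V → (i : ι) → Matrix (Fin (p i)) X ℝ}
    (hH : ∀ i, HasAnalyticEntries fun θ => H θ i) (Gα : ι → ι → Prop) :
    HasAnalyticEntries fun θ => DH Gα (H θ) := fun a b => by
  by_cases hab : a.1 = b.1
  · simpa only [CyberSocial.DH, Matrix.of_apply, if_pos hab] using
      sum _ (fun j _ => (hH j).transpose.mul (hH j)) a.2 b.2
  · simpa only [CyberSocial.DH, Matrix.of_apply, if_neg hab] using analyticOnNhd_const

end HasAnalyticEntries

section WeightMatrix

variable {ι : Type*} [Fintype ι] {G : ι → ι → Prop} {w : ι → ι → ℝ}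

lemma weightMatrix_apply_of_ne {i j : ι} (hij : i ≠ j) :
    weightMatrix G w i j = systemMatrix G w i j := by
  simp [weightMatrix, systemMatrix, hij]

lemma weightMatrix_ne_zero_iff (hw : ∀ i j, w i j ≠ 0) (hdiag : ∀ i, weightMatrix G w i i ≠ 0)
    (i j : ι) : weightMatrix G w i j ≠ 0 ↔ j ∈ nbhd G i := by
  rcases eq_or_ne j i with rfl | hji
  · exact iff_of_true (hdiag j) (.inl rfl)
  · simp [weightMatrix_apply_of_ne hji.symm, systemMatrix, nbhd, hji, hw]

lemma weightMatrix_apply_self [DecidableEq ι] (i : ι) :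
    weightMatrix G w i i = 1 - ∑ k ∈ Finset.univ.erase i, systemMatrix G w i k := by
  classical
  simp only [weightMatrix, systemMatrix, Matrix.of_apply, if_true, ← Finset.filter_ne',
    ← Finset.sum_filter, Finset.filter_filter]
  congr!

lemma weightMatrix_mulVec_one : weightMatrix G w *ᵥ 1 = 1 := by
  classical
  ext i
  suffices ∑ j, weightMatrix G w i j = 1 by simpa [Matrix.mulVec, dotProduct]
  rw [← Finset.add_sum_erase _ _ (Finset.mem_univ i), weightMatrix_apply_self,
    Finset.sum_congr rfl fun j hj => weightMatrix_apply_of_ne (Finset.ne_of_mem_erase hj).symm,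
    sub_add_cancel]

lemma IsAdmissibleWeight.weightMatrix_eq {W : Matrix ι ι ℝ} (hW : IsAdmissibleWeight G W) :
    weightMatrix G (fun i j => W i j) = W := by
  classical
  have hoff : ∀ i j, i ≠ j → systemMatrix G (fun i j => W i j) i j = W i j := fun i j hij => by
    by_cases hG : G i j
    · simp [systemMatrix, hG]
    · simp [systemMatrix, hG, not_imp_comm.1 (hW.1 i j hij) hG]
  ext i j
  rcases eq_or_ne i j with rfl | hij
  · have hrow : ∑ j, W i j = 1 := by simpa [Matrix.mulVec, dotProduct] using congrFun hW.2 i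
    rw [← Finset.add_sum_erase _ _ (Finset.mem_univ i)] at hrow
    rw [weightMatrix_apply_self, Finset.sum_congr rfl fun j hj =>
      hoff i j (Finset.ne_of_mem_erase hj).symm, ← hrow, add_sub_cancel_right]
  · exact (weightMatrix_apply_of_ne hij).trans (hoff i j hij)

lemma weightMatrix_self_pos (hw : ∀ i j, w i j < 1 / (Fintype.card ι + 1)) (i : ι) :
    0 < weightMatrix G w i i := by
  classical
  have hentry : ∀ k, systemMatrix G w i k ≤ 1 / (Fintype.card ι + 1) := fun k => by
    by_cases hG : G i k
    · simpa only [systemMatrix, Matrix.of_apply, if_pos hG] using (hw i k).le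
    · simp only [systemMatrix, Matrix.of_apply, if_neg hG]
      positivity
  rw [weightMatrix_apply_self, sub_pos]
  calc ∑ k ∈ Finset.univ.erase i, systemMatrix G w i k
      ≤ ∑ k ∈ Finset.univ.erase i, 1 / ((Fintype.card ι : ℝ) + 1) :=
        Finset.sum_le_sum fun k _ => hentry k
    _ ≤ ∑ _k : ι, 1 / ((Fintype.card ι : ℝ) + 1) :=
        Finset.sum_le_sum_of_subset_of_nonneg (Finset.erase_subset _ _) fun _ _ _ => by positivity
    _ = Fintype.card ι / (Fintype.card ι + 1) := by
        rw [Finset.sum_const, Finset.card_univ, nsmul_eq_mul, mul_one_div]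
    _ < 1 := (div_lt_one (by positivity)).2 (lt_add_one _)

lemma weightMatrix_mem_rowStochastic [DecidableEq ι] (hw : ∀ i j, 0 ≤ w i j)
    (hdiag : ∀ i, 0 ≤ weightMatrix G w i i) : weightMatrix G w ∈ rowStochastic ℝ ι := by
  refine mem_rowStochastic.2 ⟨fun i j => ?_, weightMatrix_mulVec_one⟩
  rcases eq_or_ne i j with rfl | hij
  · exact hdiag i
  · by_cases hG : G i j <;> simp [weightMatrix_apply_of_ne hij, systemMatrix, hG, hw]

lemma HasAnalyticEntries.weightMatrix {V : Type*} [NormedAddCommGroup V] [NormedSpace ℝ V]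
    {w : V → ι → ι → ℝ} (hw : ∀ i j, AnalyticOnNhd ℝ (fun θ => w θ i j) Set.univ)
    (G : ι → ι → Prop) :
    HasAnalyticEntries fun θ => weightMatrix G (w θ) := fun i j => by
  classical
  rcases eq_or_ne i j with rfl | hij
  · simp only [weightMatrix_apply_self]
    exact analyticOnNhd_const.sub
      (Finset.analyticOnNhd_fun_sum _ fun k _ => HasAnalyticEntries.systemMatrix hw G i k)
  · simpa only [weightMatrix_apply_of_ne hij] using HasAnalyticEntries.systemMatrix hw G i j

end WeightMatrix

lemma systemMatrix_ne_zero_iff {X : Type*} {E : X → X → Prop} {a : X → X → ℝ}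
    (ha : ∀ x y, a x y ≠ 0) (x y : X) : systemMatrix E a x y ≠ 0 ↔ E x y := by
  simp [systemMatrix, ha]

section Measurements

variable {ι X : Type*} {p : ι → ℕ}

lemma measurementMatrix_ne_zero_iff {s : (i : ι) → Fin (p i) → X} {h : (i : ι) → Fin (p i) → ℝ}
    (hh : ∀ i r, h i r ≠ 0) (i : ι) (r : Fin (p i)) (x : X) :
    measurementMatrix s h i r x ≠ 0 ↔ x = s i r := by
  simp [measurementMatrix, hh]

/-- The states that are measured by agent `i` or by an agent sending its measurements to `i`. -/
def measuredStates (Gα : ι → ι → Prop) (s : (i : ι) → Fin (p i) → X) (i : ι) : Set X :=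
  {x | ∃ j ∈ nbhd Gα i, ∃ r, s j r = x}

lemma exists_mem_measuredStates_of_isContraction {E : X → X → Prop} {Gα : ι → ι → Prop}
    {s : (i : ι) → Fin (p i) → X}
    (hα : ∀ i C, IsContraction E C → ∃ j ∈ nbhd Gα i, Measures s j C) (i : ι) (C : Set X)
    (hC : IsContraction E C) : ∃ y ∈ measuredStates Gα s i, y ∈ C := by
  obtain ⟨j, hj, r, hr⟩ := hα i C hC
  exact ⟨s j r, ⟨j, hj, r, rfl⟩, hr⟩

variable [Fintype X]

lemma measurementMatrix_mulVec (s : (i : ι) → Fin (p i) → X) (h : (i : ι) → Fin (p i) → ℝ)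
    (i : ι) (v : X → ℝ) : measurementMatrix s h i *ᵥ v = fun r => h i r * v (s i r) := by
  classical
  ext r
  simp [measurementMatrix, Matrix.mulVec, dotProduct]

variable [Fintype ι]

lemma DH_mulVec_eq_zero_iff (Gα : ι → ι → Prop) (H : (i : ι) → Matrix (Fin (p i)) X ℝ)
    (v : ι × X → ℝ) :
    DH Gα H *ᵥ v = 0 ↔ ∀ i, ∀ j ∈ nbhd Gα i, H j *ᵥ (fun x => v (i, x)) = 0 := by
  classical
  have hblock : ∀ i x, (DH Gα H *ᵥ v) (i, x) =
      ((∑ j ∈ Finset.univ.filter (· ∈ nbhd Gα i), (H j)ᵀ * H j) *ᵥ fun x => v (i, x)) x := by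
    intro i x
    simp only [Matrix.mulVec, dotProduct, Fintype.sum_prod_type, DH, Matrix.of_apply]
    rw [Fintype.sum_eq_single i fun j hj => by simp [hj.symm]]
    simp
  have hker : ∀ i, (∀ x, (DH Gα H *ᵥ v) (i, x) = 0) ↔
      ∀ j ∈ nbhd Gα i, H j *ᵥ (fun x => v (i, x)) = 0 := fun i => by
    simp only [hblock]
    exact funext_iff.symm.trans ((sum_transpose_mul_self_mulVec_eq_zero_iff _ _ _).trans (by simp))
  simp only [funext_iff (g := (0 : ι × X → ℝ)), Prod.forall, Pi.zero_apply, hker]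

lemma DH_measurementMatrix_mulVec_eq_zero_iff (Gα : ι → ι → Prop) (s : (i : ι) → Fin (p i) → X)
    {h : (i : ι) → Fin (p i) → ℝ} (hh : ∀ i r, h i r ≠ 0) (v : ι × X → ℝ) :
    DH Gα (measurementMatrix s h) *ᵥ v = 0 ↔
      ∀ y ∈ {q : ι × X | q.2 ∈ measuredStates Gα s q.1}, v y = 0 := by
  rw [DH_mulVec_eq_zero_iff]
  simp only [measurementMatrix_mulVec, funext_iff, Pi.zero_apply, mul_eq_zero, hh, false_or,
    measuredStates, Set.mem_ofPred_eq, Prod.forall]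
  exact forall_congr' fun i => ⟨by rintro h _ ⟨j, hj, r, rfl⟩; exact h j hj r,
    fun h j hj r => h _ ⟨j, hj, r, rfl⟩⟩

end Measurements

section ParameterSpace

variable {ι X : Type*} [Fintype ι] [Fintype X] {p : ι → ℕ}

instance isAddHaarMeasure_volume_parameters :
    (volume : Measure ((X → X → ℝ) × (ι → ι → ℝ) × ((i : ι) → Fin (p i) → ℝ))).IsAddHaarMeasure :=
  have : (volume : Measure ((ι → ι → ℝ) × ((i : ι) → Fin (p i) → ℝ))).IsAddHaarMeasure :=
    Measure.prod.instIsAddHaarMeasure _ _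
  Measure.prod.instIsAddHaarMeasure _ _

lemma exists_pos_and_lt_of_ae {δ : ℝ} (hδ : 0 < δ)
    {P : (X → X → ℝ) × (ι → ι → ℝ) × ((i : ι) → Fin (p i) → ℝ) → Prop} (hP : ∀ᵐ θ, P θ) :
    ∃ a w h, (∀ x y, 0 < a x y) ∧ (∀ i j, 0 < w i j ∧ w i j < δ) ∧ (∀ i r, 0 < h i r) ∧
      P (a, w, h) := by
  set θ₀ : (X → X → ℝ) × (ι → ι → ℝ) × ((i : ι) → Fin (p i) → ℝ) :=
    (fun _ _ => 1, fun _ _ => δ / 2, fun _ _ => 1)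
  have hbox : ∀ᶠ θ in nhds θ₀, (∀ x y, 0 < θ.1 x y) ∧
      (∀ i j, 0 < θ.2.1 i j ∧ θ.2.1 i j < δ) ∧ ∀ i r, 0 < θ.2.2 i r := by
    simp only [Filter.eventually_and, Filter.eventually_all]
    refine ⟨fun x y => ?_, fun i j => ⟨?_, ?_⟩, fun i r => ?_⟩
    · exact (by fun_prop : Continuous _).continuousAt.eventually_const_lt one_pos
    · exact (by fun_prop : Continuous _).continuousAt.eventually_const_lt (half_pos hδ)
    · exact (by fun_prop : Continuous _).continuousAt.eventually_lt_const (half_lt_self hδ)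
    · exact (by fun_prop : Continuous _).continuousAt.eventually_const_lt one_pos
  have hfreq := mem_closure_iff_frequently.1 (Measure.dense_of_ae hP θ₀)
  obtain ⟨⟨a, w, h⟩, hPθ, ha, hw, hh⟩ := (hfreq.and_eventually hbox).exists
  exact ⟨a, w, h, ha, hw, hh, hPθ⟩

end ParameterSpace

variable {ι X : Type*} [Fintype X]
  {E : X → X → Prop} {Gα Gβ : ι → ι → Prop} {p : ι → ℕ} {s : (i : ι) → Fin (p i) → X}

lemma ae_noHiddenMode_iUnion_measuredStates
    (hα : ∀ i C, IsContraction E C → ∃ j ∈ nbhd Gα i, Measures s j C)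
    (hβ : ∀ i S, IsParentSCC E S → ∃ j, Measures s j S ∧ HasPath Gβ j i ∧ HasPath Gβ i j) (i : ι) :
    ∀ᵐ a, NoHiddenMode (systemMatrix E a)
      (⋃ j ∈ {j | HasPath Gβ i j ∧ HasPath Gβ j i}, measuredStates Gα s j) := by
  set Y : Set X := ⋃ j ∈ {j | HasPath Gβ i j ∧ HasPath Gβ j i}, measuredStates Gα s j
  have hsub : ∀ {j}, HasPath Gβ i j → HasPath Gβ j i → measuredStates Gα s j ⊆ Y :=
    fun hij hji => Set.subset_biUnion_of_mem (u := measuredStates Gα s) ⟨hij, hji⟩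
  have hC : ∀ C, IsContraction E C → ∃ y ∈ Y, y ∈ C := fun C hC => by
    obtain ⟨y, hy, hyC⟩ := exists_mem_measuredStates_of_isContraction hα i C hC
    exact ⟨y, hsub .refl .refl hy, hyC⟩
  have hS : ∀ S, IsParentSCC E S → ∃ y ∈ Y, y ∈ S := fun S hS => by
    obtain ⟨j, ⟨r, hr⟩, hji, hij⟩ := hβ i S hS
    exact ⟨s j r, hsub hij hji ⟨j, .inl rfl, r, rfl⟩, hr⟩
  obtain ⟨π, hπ⟩ := exists_perm_of_forall_isContraction hC
  obtain ⟨a₀, ha₀⟩ := exists_noHiddenMode hπ (exists_hasPath_of_forall_isParentSCC hS)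
  have hanalytic : HasAnalyticEntries fun a : X → X → ℝ => systemMatrix E a :=
    .systemMatrix (analyticOnNhd_apply_apply fun _ _ => analyticAt_id) E
  exact ae_noHiddenMode hanalytic a₀ ha₀ volume

variable [Fintype ι] [DecidableEq ι] [DecidableEq X]

lemma exists_isObservable_weightMatrix_kronecker
    (hα : ∀ i C, IsContraction E C → ∃ j ∈ nbhd Gα i, Measures s j C)
    (hβ : ∀ i S, IsParentSCC E S → ∃ j, Measures s j S ∧ HasPath Gβ j i ∧ HasPath Gβ i j) :
    ∃ (a : X → X → ℝ) (w : ι → ι → ℝ), IsObservable (weightMatrix Gβ w ⊗ₖ systemMatrix E a)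
      (DH Gα (measurementMatrix s 1)) := by
  have hker : ∀ i, ∀ᵐ a : X → X → ℝ, ∀ z, complexify (systemMatrix E a) *ᵥ z = 0 →
      (∀ x ∈ measuredStates Gα s i, z x = 0) → z = 0 := fun i => by
    obtain ⟨π, hπ⟩ := exists_perm_of_forall_isContraction
      (exists_mem_measuredStates_of_isContraction hα i)
    exact ae_ker_systemMatrix_eq_zero hπ
  obtain ⟨a, hker, hno⟩ := ((ae_all_iff.2 hker).and
    (ae_all_iff.2 (ae_noHiddenMode_iUnion_measuredStates hα hβ))).exists
  obtain ⟨W, hW, hWA⟩ := exists_noHiddenMode_kronecker hker hno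
  refine ⟨a, fun i j => W i j, ?_⟩
  rw [hW.weightMatrix_eq]
  exact (isObservable_iff_noHiddenMode (DH_measurementMatrix_mulVec_eq_zero_iff Gα s
    fun _ _ => one_ne_zero)).2 hWA

variable (E Gα Gβ s)

lemma ae_isObservable_weightMatrix_kronecker {a : X → X → ℝ} {w : ι → ι → ℝ}
    {h : (i : ι) → Fin (p i) → ℝ} (hobs : IsObservable (weightMatrix Gβ w ⊗ₖ systemMatrix E a)
      (DH Gα (measurementMatrix s h))) :
    ∀ᵐ θ : (X → X → ℝ) × (ι → ι → ℝ) × ((i : ι) → Fin (p i) → ℝ) ∂volume,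
      IsObservable (weightMatrix Gβ θ.2.1 ⊗ₖ systemMatrix E θ.1)
        (DH Gα (measurementMatrix s θ.2.2)) := by
  have hA : HasAnalyticEntries fun θ : (X → X → ℝ) × (ι → ι → ℝ) × ((i : ι) → Fin (p i) → ℝ) =>
      systemMatrix E θ.1 :=
    .systemMatrix (analyticOnNhd_apply_apply analyticOnNhd_fst) E
  have hW : HasAnalyticEntries fun θ : (X → X → ℝ) × (ι → ι → ℝ) × ((i : ι) → Fin (p i) → ℝ) =>
      weightMatrix Gβ θ.2.1 :=
    .weightMatrix (analyticOnNhd_apply_apply fun _ _ => analyticAt_fst.comp analyticAt_snd) Gβ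
  have hH : HasAnalyticEntries fun θ : (X → X → ℝ) × (ι → ι → ℝ) × ((i : ι) → Fin (p i) → ℝ) =>
      DH Gα (measurementMatrix s θ.2.2) :=
    .DH (.measurementMatrix
      (analyticOnNhd_apply_apply fun _ _ => analyticAt_snd.comp analyticAt_snd) s) Gα
  exact ae_isObservable (hW.kronecker hA) hH (a, w, h) hobs volume

end NetworkedSystem

end CyberSocial

theorem theorem3 {ι X : Type*} [Fintype ι] [DecidableEq ι] [Fintype X] [DecidableEq X]
    -- the social digraph, the measurement-sharing and the prediction-sharing network
    (E : X → X → Prop) (Gα Gβ : ι → ι → Prop)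
    -- the measurements: the `r`-th measurement of agent `i` is of the state `s i r`
    {p : ι → ℕ} (s : (i : ι) → Fin (p i) → X)
    -- (i) direct links from Type-α agents
    (hα : ∀ i : ι, ∀ C : Set X, CyberSocial.IsContraction E C →
      ∃ j ∈ CyberSocial.nbhd Gα i, CyberSocial.Measures s j C)
    -- (ii) paths of prediction-sharing links from (and back to) Type-β agents
    (hβ : ∀ i : ι, ∀ S : Set X, CyberSocial.IsParentSCC E S →
      ∃ j : ι, CyberSocial.Measures s j S ∧
        CyberSocial.HasPath Gβ j i ∧ CyberSocial.HasPath Gβ i j) :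
    CyberSocial.IsStructurallyObservable E Gα Gβ s := by
  obtain ⟨a₀, w₀, h₀⟩ := CyberSocial.exists_isObservable_weightMatrix_kronecker hα hβ
  have hae := CyberSocial.ae_isObservable_weightMatrix_kronecker E Gα Gβ s h₀
  obtain ⟨a, w, h, ha, hw, hh, hobs⟩ :=
    CyberSocial.exists_pos_and_lt_of_ae (δ := 1 / (Fintype.card ι + 1)) (by positivity) hae
  have hdiag := CyberSocial.weightMatrix_self_pos (G := Gβ) fun i j => (hw i j).2
  exact ⟨⟨CyberSocial.systemMatrix E a, CyberSocial.weightMatrix Gβ w,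
    CyberSocial.measurementMatrix s h,
    CyberSocial.systemMatrix_ne_zero_iff fun x y => (ha x y).ne',
    CyberSocial.weightMatrix_mem_rowStochastic (fun i j => (hw i j).1.le) fun i => (hdiag i).le,
    CyberSocial.weightMatrix_ne_zero_iff (fun i j => (hw i j).1.ne') fun i => (hdiag i).ne',
    CyberSocial.measurementMatrix_ne_zero_iff fun i r => (hh i r).ne', hobs⟩, hae⟩
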